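/- **Lemma 2 (Flipping Lemma).** Let $B^3\subset\mathbb{R}^3$ be a round ball centred at the origin, and fix four endpoints NW, NE, SW, SE on its boundary sphere, lying in the projection plane $z=0$ at the corners of a square with horizontal and vertical sides. A $2$-tangle is a set properly embedded in $B^3$, consisting of two arcs with these four endpoints and finitely many circles. Write $T\sim S$ ($T$ and $S$ are isotopic) if there is an orientation-preserving self-homeomorphism of $B^3$ that is the identity on the boundary and carries $T$ onto $S$. Let $[0]$ and $[\infty]$ be the tangles consisting of two horizontal, respectively two vertical, straight arcs, and $[+1],[-1]$ the two tangles consisting of a single crossing. The sum $T+S$ is formed by placing $T$ to the left of $S$ and joining the right endpoints of $T$ to the left endpoints of $S$; the product $T*S$ is formed by placing $T$ above $S$ and joining the lower endpoints of $T$ to the upper endpoints of $S$. A tangle is *rational* if it is isotopic to one obtained from $[0]$ or $[\infty]$ by finitely many additions and multiplications, on either side, by $[+1]$ and $[-1]$. Let $T^{hflip}$ and $T^{vflip}$ be the images of $T$ under the $180^\circ$ rotations of space about the horizontal axis and about the vertical axis of the projection plane, let $T^r$ be the image of $T$ under the counterclockwise $90^\circ$ rotation of the projection plane, let $-T$ be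 the mirror image of $T$ in the projection plane (all crossings switched), and put $T^i=-(T^r)$. Let $T^{-i}$ be the image of $-T$ under the clockwise $90^\circ$ rotation of the projection plane. If $T$ is a rational tangle, then (i) $T\sim T^{hflip}$; (ii) $T\sim T^{vflip}$; (iii) $T\sim (T^i)^i=(T^r)^r$. Consequently $T^i\sim T^{-i}$, that is, inversion, which cancels $T\mapsto T^{-i}$, has order two on rational tangles up to isotopy. -/

import Mathlib

namespace RatTangle

/-- Euclidean three-space. -/
abbrev E3 := EuclideanSpace ℝ (Fin 3)

/-- The point with coordinates `(x, y, z)`. The plane of the diagrams is `z = 0`, with the `x`-axis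
pointing to the right, the `y`-axis pointing up and the `z`-axis pointing towards the viewer. -/
noncomputable def pt (x y z : ℝ) : E3 := !₂[x, y, z]

/-- The 3-ball `B³`. The radius `√2` makes `(±1, ±1, 0)`, the four endpoints of a 2-tangle
(NW, NE, SW, SE), lie on the bounding sphere. -/
abbrev B3 := ↥(Metric.closedBall (0 : E3) (Real.sqrt 2))

/-- The points of the ball on the straight segment from `p` to `q`. -/
def seg (p q : E3) : Set B3 := {x | x.1 ∈ segment ℝ p q}

/-! ### Isotopy -/

/-- A self-homeomorphism of the ball preserves orientation if it is isotopic to the identity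
through self-homeomorphisms of the ball. -/
def OrientationPreserving (h : B3 ≃ₜ B3) : Prop :=
  ∃ H : unitInterval → (B3 ≃ₜ B3), H 0 = Homeomorph.refl B3 ∧ H 1 = h ∧
    Continuous fun p : unitInterval × B3 => H p.1 p.2

/-- `T ∼ S`: there is an orientation-preserving self-homeomorphism of the ball that is the identity
on the boundary sphere and carries `T` onto `S`. -/
def Isotopic (T S : Set B3) : Prop :=
  ∃ h : B3 ≃ₜ B3, OrientationPreserving h ∧
    (∀ p : B3, ‖p.1‖ = Real.sqrt 2 → h p = p) ∧ h '' T = S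

/-! ### The elementary tangles -/

/-- `[0]`: two horizontal arcs, NW–NE and SW–SE. -/
noncomputable def zero : Set B3 :=
  seg (pt (-1) 1 0) (pt 1 1 0) ∪ seg (pt (-1) (-1) 0) (pt 1 (-1) 0)

/-- `[∞]`: two vertical arcs, NW–SW and NE–SE. -/
noncomputable def infty : Set B3 :=
  seg (pt (-1) 1 0) (pt (-1) (-1) 0) ∪ seg (pt 1 1 0) (pt 1 (-1) 0)

/-- A single crossing of two arcs. The arc NW–SE passes through `(0, 0, ε)` and the arc SW–NE
passes through `(0, 0, -ε)`. -/
noncomputable def crossing (ε : ℝ) : Set B3 :=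
  (seg (pt (-1) 1 0) (pt 0 0 ε) ∪ seg (pt 0 0 ε) (pt 1 (-1) 0)) ∪
    (seg (pt (-1) (-1) 0) (pt 0 0 (-ε)) ∪ seg (pt 0 0 (-ε)) (pt 1 1 0))

/-- `[+1]`: the arc NW–SE crosses over. -/
noncomputable def posOne : Set B3 := crossing 1

/-- `[-1]`: the arc NW–SE crosses under. -/
noncomputable def negOne : Set B3 := crossing (-1)

/-! ### Operations on 2-tangles -/

/-- A copy of `T` shrunk by the factor `1/4` and centred at `c`. -/
noncomputable def place (c : E3) (T : Set B3) : Set B3 :=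
  {p | ∃ q ∈ T, p.1 = c + (1 / 4 : ℝ) • q.1}

/-- The sum `T + S`: `T` on the left, `S` on the right. The two eastern endpoints of `T` are joined
by arcs to the western endpoints of `S`; the remaining four endpoints are joined to the endpoints
on the big sphere. -/
noncomputable def add (T S : Set B3) : Set B3 :=
  place (pt (-1 / 2) 0 0) T ∪ place (pt (1 / 2) 0 0) S ∪
    (seg (pt (-1) 1 0) (pt (-3 / 4) (1 / 4) 0) ∪
     seg (pt (-1) (-1) 0) (pt (-3 / 4) (-1 / 4) 0) ∪
     seg (pt (-1 / 4) (1 / 4) 0) (pt (1 / 4) (1 / 4) 0) ∪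
     seg (pt (-1 / 4) (-1 / 4) 0) (pt (1 / 4) (-1 / 4) 0) ∪
     seg (pt (3 / 4) (1 / 4) 0) (pt 1 1 0) ∪
     seg (pt (3 / 4) (-1 / 4) 0) (pt 1 (-1) 0))

/-- The product `T * S`: `T` on top, `S` at the bottom. The two southern endpoints of `T` are joined
by arcs to the northern endpoints of `S`; the remaining four endpoints are joined to the endpoints
on the big sphere. -/
noncomputable def mul (T S : Set B3) : Set B3 :=
  place (pt 0 (1 / 2) 0) T ∪ place (pt 0 (-1 / 2) 0) S ∪
    (seg (pt (-1) 1 0) (pt (-1 / 4) (3 / 4) 0) ∪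
     seg (pt 1 1 0) (pt (1 / 4) (3 / 4) 0) ∪
     seg (pt (-1 / 4) (1 / 4) 0) (pt (-1 / 4) (-1 / 4) 0) ∪
     seg (pt (1 / 4) (1 / 4) 0) (pt (1 / 4) (-1 / 4) 0) ∪
     seg (pt (-1 / 4) (-3 / 4) 0) (pt (-1) (-1) 0) ∪
     seg (pt (1 / 4) (-3 / 4) 0) (pt 1 (-1) 0))

/-- Horizontal flip: rotation in space by 180° around the horizontal axis (the `x`-axis). -/
def hflip (T : Set B3) : Set B3 := {p | ∃ q ∈ T, p.1 = pt (q.1 0) (-q.1 1) (-q.1 2)}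

/-- Vertical flip: rotation in space by 180° around the vertical axis (the `y`-axis). -/
def vflip (T : Set B3) : Set B3 := {p | ∃ q ∈ T, p.1 = pt (-q.1 0) (q.1 1) (-q.1 2)}

/-- The rotation `T^r`: counterclockwise rotation of the plane of the tangle by 90°. -/
def rot (T : Set B3) : Set B3 := {p | ∃ q ∈ T, p.1 = pt (-q.1 1) (q.1 0) (q.1 2)}

/-- Clockwise rotation of the plane of the tangle by 90°. -/
def rotCW (T : Set B3) : Set B3 := {p | ∃ q ∈ T, p.1 = pt (q.1 1) (-q.1 0) (q.1 2)}

/-- The mirror image `-T`: reflection in the plane of the tangle, which switches all crossings. -/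
def mirror (T : Set B3) : Set B3 := {p | ∃ q ∈ T, p.1 = pt (q.1 0) (q.1 1) (-q.1 2)}

/-- The inverse `T^i = -T^r`. -/
def inv (T : Set B3) : Set B3 := mirror (rot T)

/-- `T^{-i}`, the operation cancelling `T^i`: the mirror image turned clockwise by 90°. -/
def invNeg (T : Set B3) : Set B3 := mirror (rotCW T)

/-! ### Rational tangles -/

/-- Tangles in twist form: those created from `[0]` or `[∞]` by consecutive additions and
multiplications, on either side, by `[+1]` and `[-1]`. -/
inductive TwistForm : Set B3 → Prop
  | zero : TwistForm zero
  | infty : TwistForm infty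
  | add_right {T e : Set B3} (he : e = posOne ∨ e = negOne) : TwistForm T → TwistForm (add T e)
  | add_left {T e : Set B3} (he : e = posOne ∨ e = negOne) : TwistForm T → TwistForm (add e T)
  | mul_bottom {T e : Set B3} (he : e = posOne ∨ e = negOne) : TwistForm T → TwistForm (mul T e)
  | mul_top {T e : Set B3} (he : e = posOne ∨ e = negOne) : TwistForm T → TwistForm (mul e T)

/-- A tangle is rational if it is isotopic to a tangle in twist form. -/
def Rational (T : Set B3) : Prop := ∃ S : Set B3, TwistForm S ∧ Isotopic S T

end RatTangle

namespace RatTangle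

/-! The proof shows, by induction over twist forms, that a tangle is isotopic to both of its flips
at once. Both are needed together: the composite of the two flips is the half turn of the projection
plane, so they give `T ∼ (T^r)^r`, and this feeds the inductive step.

For `T + c` with `c` a crossing, the horizontal flip acts on each summand and fixes `c`, so only `T`
has to be replaced by an isotopic tangle (`Isotopic.add_right`). The vertical flip of `T + c` is `c
+ T^{vflip}`. The crossing is carried across by a flype, `T + c ∼ c + T^{hflip}` (`isotopic_flype`),
applied to `(T^r)^r`, whose horizontal flip is `T^{vflip}`. Crossings added on the left follow by
conjugating with the vertical flip, and products follow by a quarter turn, which turns products into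
sums, `[∞]` into `[0]`, and a crossing into the opposite one.

The flype is built explicitly in cylindrical coordinates `(x, w)`, `w ∈ ℂ`, around the horizontal
axis. To the right of `T` the strands form a pair `±w(x)` whose direction turns from `1` to `-1`; to
the left they form a pair with constant direction. A radial map followed by a slide along the axis
(`centre`) moves `T` to the centre and makes the left and right pairs symmetric in distance from the
axis and in position, so that they differ only in direction. A rotation about the axis, by an angle
depending on the point, then turns `T` over, untwists the right pair and twists the left pair in
exchange.

Orientation is never an obstacle: by Alexander's trick every homeomorphism of the ball fixing the
boundary is isotopic to the identity. -/

/-! ### Homeomorphisms of space supported in the ball -/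

/-- A continuous bijection of space which is the identity off the open ball of radius `√2`. -/
structure Supported (f : E3 → E3) : Prop where
  continuous : Continuous f
  bijective : Function.Bijective f
  eq_self : ∀ p : E3, Real.sqrt 2 ≤ ‖p‖ → f p = p

theorem norm_coe_le (p : B3) : ‖p.1‖ ≤ Real.sqrt 2 := mem_closedBall_zero_iff.1 p.2

theorem sqrt_two_pos : 0 < Real.sqrt 2 := Real.sqrt_pos.2 (by norm_num)

namespace Supported

theorem comp {f g : E3 → E3} (hf : Supported f) (hg : Supported g) : Supported (f ∘ g) where
  continuous := hf.continuous.comp hg.continuous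
  bijective := hf.bijective.comp hg.bijective
  eq_self p hp := by simp [hg.eq_self p hp, hf.eq_self p hp]

/-- If a point of the ball were sent outside, its image would be a fixed point, contradicting
injectivity. -/
theorem norm_le {f : E3 → E3} (hf : Supported f) {p : E3} (hp : ‖p‖ ≤ Real.sqrt 2) :
    ‖f p‖ ≤ Real.sqrt 2 := by
  by_contra! h
  have := hf.bijective.1 (hf.eq_self _ h.le)
  rw [this] at h
  exact absurd hp (not_le.2 h)

theorem norm_sub_le {f : E3 → E3} (hf : Supported f) (p : E3) :
    ‖f p - p‖ ≤ 2 * Real.sqrt 2 := by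
  rcases le_total ‖p‖ (Real.sqrt 2) with h | h
  · have := hf.norm_le h
    linarith [_root_.norm_sub_le (f p) p]
  · rw [hf.eq_self p h]
    simp

/-- The restriction to the ball of a map supported in the ball. -/
def onBall {f : E3 → E3} (hf : Supported f) : B3 → B3 :=
  fun p => ⟨f p.1, mem_closedBall_zero_iff.2 (hf.norm_le (norm_coe_le p))⟩

theorem onBall_bijective {f : E3 → E3} (hf : Supported f) :
    Function.Bijective hf.onBall := by
  constructor
  · intro p q h
    exact Subtype.ext (hf.bijective.1 (congrArg Subtype.val h))
  · intro p
    obtain ⟨q, hq⟩ := hf.bijective.2 p.1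
    have hp := norm_coe_le p
    have hq' : ‖q‖ ≤ Real.sqrt 2 := by
      by_contra! h
      rw [hf.eq_self q h.le] at hq
      rw [hq] at h
      exact absurd hp (not_le.2 h)
    exact ⟨⟨q, by simpa using hq'⟩, Subtype.ext hq⟩

/-- The homeomorphism of the ball given by a map supported in the ball. -/
noncomputable def homeo {f : E3 → E3} (hf : Supported f) : B3 ≃ₜ B3 :=
  Continuous.homeoOfEquivCompactToT2 (f := Equiv.ofBijective hf.onBall hf.onBall_bijective)
    ((hf.continuous.comp continuous_subtype_val).subtype_mk _)

@[simp] theorem homeo_apply {f : E3 → E3} (hf : Supported f) (p : B3) :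
    (hf.homeo p).1 = f p.1 := rfl

end Supported

/-! ### Alexander's trick -/

/-- The rescaled map `p ↦ t f (p / t)` (the identity for `t = 0`). -/
noncomputable def shrink (f : E3 → E3) (t : ℝ) (p : E3) : E3 :=
  p + t • (f (t⁻¹ • p) - t⁻¹ • p)

theorem shrink_zero (f : E3 → E3) (p : E3) : shrink f 0 p = p := by simp [shrink]

theorem shrink_of_ne_zero (f : E3 → E3) {t : ℝ} (ht : t ≠ 0) (p : E3) :
    shrink f t p = t • f (t⁻¹ • p) := by
  simp [shrink, smul_sub, smul_smul, ht]

theorem Supported.shrink_eq_self {f : E3 → E3} (hf : Supported f) {t : ℝ} (ht : 0 < t) {p : E3}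
    (hp : t * Real.sqrt 2 ≤ ‖p‖) : shrink f t p = p := by
  rw [shrink, hf.eq_self]
  · simp
  · rw [norm_smul, norm_inv, Real.norm_eq_abs, abs_of_pos ht, inv_mul_eq_div, le_div_iff₀ ht]
    linarith

theorem Supported.bijective_smul_conj {f : E3 → E3} (hf : Supported f) {t : ℝ} (ht : t ≠ 0) :
    Function.Bijective fun p => t • f (t⁻¹ • p) :=
  (MulAction.bijective₀ ht).comp (hf.bijective.comp (MulAction.bijective₀ (inv_ne_zero ht)))

theorem Supported.shrink {f : E3 → E3} (hf : Supported f) {t : ℝ} (h0 : 0 ≤ t) (h1 : t ≤ 1) :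
    Supported (shrink f t) := by
  rcases h0.eq_or_lt with rfl | h
  · rw [show RatTangle.shrink f 0 = id from funext (shrink_zero f)]
    exact ⟨continuous_id, Function.bijective_id, fun _ _ => rfl⟩
  · refine ⟨?_, ?_, fun p hp => hf.shrink_eq_self h ?_⟩
    · have := hf.continuous
      unfold RatTangle.shrink
      fun_prop
    · rw [funext (shrink_of_ne_zero f h.ne')]
      exact hf.bijective_smul_conj h.ne'
    · nlinarith [sqrt_two_pos]

/-- Only `t = 0` is delicate, since `t⁻¹ • p` has no limit there. The displacement of `f` is
bounded, so the rescaled displacement is at most `|t| * (2 * √2)` and tends to zero. -/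
theorem Supported.continuous_shrink {f : E3 → E3} (hf : Supported f) :
    Continuous fun a : ℝ × E3 => RatTangle.shrink f a.1 a.2 := by
  have hfc := hf.continuous
  rw [continuous_iff_continuousAt]
  rintro ⟨t, p⟩
  by_cases ht : t = 0
  · subst ht
    refine continuousAt_snd.add ?_
    rw [ContinuousAt]
    simp only [zero_smul]
    refine squeeze_zero_norm (a := fun a : ℝ × E3 => |a.1| * (2 * Real.sqrt 2)) (fun a => ?_) ?_
    · rw [norm_smul, Real.norm_eq_abs]
      exact mul_le_mul_of_nonneg_left (hf.norm_sub_le _) (abs_nonneg _)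
    · have : Continuous fun a : ℝ × E3 => |a.1| * (2 * Real.sqrt 2) := by fun_prop
      simpa using this.tendsto ((0 : ℝ), p)
  · have h1 : ContinuousAt (fun a : ℝ × E3 => a.1⁻¹ • a.2) (t, p) :=
      (continuousAt_fst.inv₀ ht).smul continuousAt_snd
    exact continuousAt_snd.add (continuousAt_fst.smul
      ((hfc.continuousAt.comp h1).sub h1))

/-- Alexander's trick. -/
theorem Supported.orientationPreserving {f : E3 → E3} (hf : Supported f) :
    OrientationPreserving hf.homeo := by
  refine ⟨fun t => (hf.shrink t.2.1 t.2.2).homeo, ?_, ?_, ?_⟩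
  · ext1 p
    exact Subtype.ext (shrink_zero f p.1)
  · ext1 p
    refine Subtype.ext ?_
    simp [RatTangle.shrink]
  · refine Continuous.subtype_mk (f := fun a : unitInterval × B3 =>
      RatTangle.shrink f a.1.1 a.2.1) ?_ _
    exact hf.continuous_shrink.comp
      ((continuous_subtype_val.comp continuous_fst).prodMk
        (continuous_subtype_val.comp continuous_snd))

/-- The radial retraction of space onto the ball. -/
noncomputable def retract (p : E3) : B3 :=
  ⟨(Real.sqrt 2 / max (Real.sqrt 2) ‖p‖) • p, by
    have h : 0 < max (Real.sqrt 2) ‖p‖ := lt_max_of_lt_left sqrt_two_pos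
    rw [mem_closedBall_zero_iff, norm_smul, Real.norm_eq_abs,
      abs_of_nonneg (div_nonneg sqrt_two_pos.le h.le), div_mul_eq_mul_div, div_le_iff₀ h]
    exact mul_le_mul_of_nonneg_left (le_max_right _ _) sqrt_two_pos.le⟩

theorem continuous_retract : Continuous retract := by
  refine Continuous.subtype_mk ?_ _
  refine Continuous.smul (continuous_const.div (continuous_const.max continuous_norm) fun p => ?_)
    continuous_id
  exact (lt_max_of_lt_left sqrt_two_pos).ne'

theorem retract_coe (p : B3) : retract p.1 = p := by
  refine Subtype.ext ?_
  have hp := norm_coe_le p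
  simp [retract, max_eq_left hp, sqrt_two_pos.ne']

theorem norm_retract {p : E3} (hp : Real.sqrt 2 ≤ ‖p‖) : ‖(retract p).1‖ = Real.sqrt 2 := by
  have h : 0 < ‖p‖ := sqrt_two_pos.trans_le hp
  simp [retract, max_eq_right hp, norm_smul, abs_of_pos sqrt_two_pos, h.ne']

/-- The extension by the identity of a map of the ball. -/
noncomputable def extend (h : B3 → B3) (p : E3) : E3 := (h (retract p)).1 + (p - (retract p).1)

theorem extend_coe (h : B3 → B3) (p : B3) : extend h p.1 = (h p).1 := by
  simp [extend, retract_coe]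

theorem extend_outside {h : B3 → B3} (hb : ∀ p : B3, ‖p.1‖ = Real.sqrt 2 → h p = p) {p : E3}
    (hp : Real.sqrt 2 ≤ ‖p‖) : extend h p = p := by
  simp [extend, hb _ (norm_retract hp)]

/-- Together with `Supported.homeo` this translates between homeomorphisms of the ball fixing the
sphere and maps of space, where rescaling and conjugation by similarities make sense. -/
theorem supported_extend (h : B3 ≃ₜ B3) (hb : ∀ p : B3, ‖p.1‖ = Real.sqrt 2 → h p = p) :
    Supported (extend h) := by
  have key : ∀ g : B3 ≃ₜ B3, (∀ p : B3, ‖p.1‖ = Real.sqrt 2 → g p = p) →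
      Function.LeftInverse (extend g.symm) (extend g) := by
    intro g hg p
    have hg' : ∀ p : B3, ‖p.1‖ = Real.sqrt 2 → g.symm p = p := fun p hp => by
      rw [Homeomorph.symm_apply_eq, hg p hp]
    rcases le_total ‖p‖ (Real.sqrt 2) with hp | hp
    · obtain ⟨q, rfl⟩ : ∃ q : B3, q.1 = p := ⟨⟨p, by simpa using hp⟩, rfl⟩
      simp [extend_coe]
    · rw [extend_outside hg hp, extend_outside hg' hp]
  refine ⟨?_, ⟨(key h hb).injective, ?_⟩, fun p hp => extend_outside hb hp⟩
  · have hr := continuous_subtype_val.comp continuous_retract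
    exact (continuous_subtype_val.comp (h.continuous.comp continuous_retract)).add
      (continuous_id.sub hr)
  · have := key h.symm fun p hp => by rw [Homeomorph.symm_apply_eq, hb p hp]
    exact (show Function.RightInverse (extend h.symm) (extend h) from this).surjective

/-- Alexander's trick for the extension makes the orientation clause in `Isotopic` automatic. -/
theorem orientationPreserving_of_boundary (h : B3 ≃ₜ B3)
    (hb : ∀ p : B3, ‖p.1‖ = Real.sqrt 2 → h p = p) : OrientationPreserving h := by
  have : (supported_extend h hb).homeo = h := by
    ext1 p
    exact Subtype.ext (extend_coe h p)
  exact this ▸ (supported_extend h hb).orientationPreserving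

/-! ### Isotopy is an equivalence relation -/

theorem isotopic_iff {T S : Set B3} : Isotopic T S ↔
    ∃ h : B3 ≃ₜ B3, (∀ p : B3, ‖p.1‖ = Real.sqrt 2 → h p = p) ∧ h '' T = S :=
  ⟨fun ⟨h, _, hb, hi⟩ => ⟨h, hb, hi⟩,
    fun ⟨h, hb, hi⟩ => ⟨h, orientationPreserving_of_boundary h hb, hb, hi⟩⟩

theorem Isotopic.symm {T S : Set B3} (h : Isotopic T S) : Isotopic S T := by
  obtain ⟨e, hb, rfl⟩ := isotopic_iff.1 h
  refine isotopic_iff.2 ⟨e.symm, fun p hp => ?_, ?_⟩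
  · rw [Homeomorph.symm_apply_eq, hb p hp]
  · rw [← Set.image_comp]
    simp

theorem Isotopic.refl (T : Set B3) : Isotopic T T :=
  isotopic_iff.2 ⟨Homeomorph.refl _, fun _ _ => rfl, by simp⟩

theorem Isotopic.trans {T S U : Set B3} (h : Isotopic T S) (h' : Isotopic S U) :
    Isotopic T U := by
  obtain ⟨e, hb, rfl⟩ := isotopic_iff.1 h
  obtain ⟨g, gb, rfl⟩ := isotopic_iff.1 h'
  refine isotopic_iff.2 ⟨e.trans g, fun p hp => ?_, ?_⟩
  · simp [hb p hp, gb p hp]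
  · rw [← Set.image_comp]
    rfl

/-- A set of points of the ball, as a set of points of space. -/
def toSpace (T : Set B3) : Set E3 := Subtype.val '' T

theorem Supported.isotopic {f : E3 → E3} (hf : Supported f) {T S : Set B3}
    (h : f '' toSpace T = toSpace S) : Isotopic T S := by
  refine isotopic_iff.2 ⟨hf.homeo, fun p hp => Subtype.ext (hf.eq_self _ hp.ge), ?_⟩
  refine Set.image_injective.2 Subtype.val_injective ?_
  change _ = toSpace S
  rw [← h, toSpace, ← Set.image_comp, ← Set.image_comp]
  rfl

theorem toSpace_preimage {f : E3 → E3} (hf : Supported f) (T : Set B3) :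
    toSpace (Subtype.val ⁻¹' (f '' toSpace T)) = f '' toSpace T := by
  refine Set.image_preimage_eq_of_subset ?_
  rintro _ ⟨_, ⟨p, _, rfl⟩, rfl⟩
  exact ⟨hf.onBall p, rfl⟩

/-- The common image is itself a subset of the ball and serves as an intermediate tangle. The flype
needs this form because both of its sides are moved to one normal position. -/
theorem Supported.isotopic₂ {f g : E3 → E3} (hf : Supported f) (hg : Supported g) {T S : Set B3}
    (h : f '' toSpace T = g '' toSpace S) : Isotopic T S := by
  refine (hf.isotopic (toSpace_preimage hf T).symm).trans (Isotopic.symm ?_)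
  rw [h]
  exact hg.isotopic (toSpace_preimage hg S).symm

theorem Isotopic.exists_supported {T S : Set B3} (h : Isotopic T S) :
    ∃ f : E3 → E3, Supported f ∧ f '' toSpace T = toSpace S := by
  obtain ⟨e, hb, rfl⟩ := isotopic_iff.1 h
  refine ⟨extend e, supported_extend e hb, ?_⟩
  simp only [toSpace, Set.image_image, extend_coe]

/-! ### Coordinates -/

@[simp] theorem pt_zero (x y z : ℝ) : pt x y z 0 = x := rfl
@[simp] theorem pt_one (x y z : ℝ) : pt x y z 1 = y := rfl
@[simp] theorem pt_two (x y z : ℝ) : pt x y z 2 = z := rfl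

theorem ext_coords {p q : E3} (h0 : p 0 = q 0) (h1 : p 1 = q 1) (h2 : p 2 = q 2) : p = q := by
  ext i
  fin_cases i <;> assumption

theorem pt_eta (p : E3) : pt (p 0) (p 1) (p 2) = p := ext_coords rfl rfl rfl

theorem norm_sq_coords (p : E3) : ‖p‖ ^ 2 = p 0 ^ 2 + p 1 ^ 2 + p 2 ^ 2 := by
  rw [EuclideanSpace.real_norm_sq_eq, Fin.sum_univ_three]

theorem norm_eq_of_coords {p q : E3} (h : p 0 ^ 2 + p 1 ^ 2 + p 2 ^ 2 =
    q 0 ^ 2 + q 1 ^ 2 + q 2 ^ 2) : ‖p‖ = ‖q‖ := by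
  rw [← norm_sq_coords, ← norm_sq_coords] at h
  exact (sq_eq_sq₀ (norm_nonneg _) (norm_nonneg _)).1 h

theorem norm_le_sqrt_two_iff {p : E3} :
    ‖p‖ ≤ Real.sqrt 2 ↔ p 0 ^ 2 + p 1 ^ 2 + p 2 ^ 2 ≤ 2 := by
  rw [Real.le_sqrt (norm_nonneg _) (by norm_num), norm_sq_coords]

theorem sqrt_two_le_norm_iff {p : E3} :
    Real.sqrt 2 ≤ ‖p‖ ↔ 2 ≤ p 0 ^ 2 + p 1 ^ 2 + p 2 ^ 2 := by
  rw [Real.sqrt_le_left (norm_nonneg _), norm_sq_coords]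

theorem continuous_pt {X : Type*} [TopologicalSpace X] {f g h : X → ℝ} (hf : Continuous f)
    (hg : Continuous g) (hh : Continuous h) : Continuous fun a => pt (f a) (g a) (h a) := by
  unfold pt
  refine (PiLp.continuous_toLp 2 _).comp (continuous_pi fun i => ?_)
  fin_cases i <;> simpa

/-! ### Pieces of tangles, as sets of points of space -/

theorem toSpace_injective : Function.Injective toSpace :=
  Set.image_injective.2 Subtype.val_injective

theorem toSpace_union (T S : Set B3) : toSpace (T ∪ S) = toSpace T ∪ toSpace S :=
  Set.image_union _ _ _

theorem toSpace_setOf {P : E3 → Prop} (h : ∀ p, P p → ‖p‖ ≤ Real.sqrt 2) :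
    toSpace {p | P p.1} = {p | P p} := by
  ext p
  constructor
  · rintro ⟨q, hq, rfl⟩
    exact hq
  · exact fun hp => ⟨⟨p, mem_closedBall_zero_iff.2 (h p hp)⟩, hp, rfl⟩

theorem toSpace_seg {p q : E3} (hp : ‖p‖ ≤ Real.sqrt 2) (hq : ‖q‖ ≤ Real.sqrt 2) :
    toSpace (seg p q) = segment ℝ p q := by
  refine toSpace_setOf fun x hx => ?_
  have := (convex_closedBall (0 : E3) (Real.sqrt 2)).segment_subset
    (mem_closedBall_zero_iff.2 hp) (mem_closedBall_zero_iff.2 hq) hx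
  exact mem_closedBall_zero_iff.1 this

/-- The similarity of ratio `1/4` that takes the origin to `c`. -/
noncomputable def quarter (c p : E3) : E3 := c + (1 / 4 : ℝ) • p

theorem exists_mem_toSpace {T : Set B3} {P : E3 → Prop} :
    (∃ q ∈ toSpace T, P q) ↔ ∃ q ∈ T, P q.1 := by
  simp [toSpace]

theorem toSpace_place {c : E3} (hc : ‖c‖ ≤ 1 / 2) (T : Set B3) :
    toSpace (place c T) = quarter c '' toSpace T := by
  have h : ∀ p, (∃ q ∈ T, p = c + (1 / 4 : ℝ) • q.1) → ‖p‖ ≤ Real.sqrt 2 := by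
    rintro _ ⟨q, _, rfl⟩
    have h1 := norm_coe_le q
    have h2 := norm_add_le c ((1 / 4 : ℝ) • q.1)
    rw [norm_smul, Real.norm_eq_abs, abs_of_pos (by norm_num : (0 : ℝ) < 1 / 4)] at h2
    have h3 : 1 ≤ Real.sqrt 2 := Real.one_le_sqrt.2 (by norm_num)
    linarith
  rw [place, toSpace_setOf (P := fun p => ∃ q ∈ T, p = c + (1 / 4 : ℝ) • q.1) h]
  ext p
  simp only [Set.mem_ofPred_eq, Set.mem_image, quarter,
    exists_mem_toSpace (P := fun q => c + (1 / 4 : ℝ) • q = p)]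
  simp only [eq_comm]

/-- The arcs of a sum outside the two small balls. -/
noncomputable def addFrame : Set E3 :=
  segment ℝ (pt (-1) 1 0) (pt (-3 / 4) (1 / 4) 0) ∪
  segment ℝ (pt (-1) (-1) 0) (pt (-3 / 4) (-1 / 4) 0) ∪
  segment ℝ (pt (-1 / 4) (1 / 4) 0) (pt (1 / 4) (1 / 4) 0) ∪
  segment ℝ (pt (-1 / 4) (-1 / 4) 0) (pt (1 / 4) (-1 / 4) 0) ∪
  segment ℝ (pt (3 / 4) (1 / 4) 0) (pt 1 1 0) ∪
  segment ℝ (pt (3 / 4) (-1 / 4) 0) (pt 1 (-1) 0)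

/-- The arcs of a product outside the two small balls. -/
noncomputable def mulFrame : Set E3 :=
  segment ℝ (pt (-1) 1 0) (pt (-1 / 4) (3 / 4) 0) ∪
  segment ℝ (pt 1 1 0) (pt (1 / 4) (3 / 4) 0) ∪
  segment ℝ (pt (-1 / 4) (1 / 4) 0) (pt (-1 / 4) (-1 / 4) 0) ∪
  segment ℝ (pt (1 / 4) (1 / 4) 0) (pt (1 / 4) (-1 / 4) 0) ∪
  segment ℝ (pt (-1 / 4) (-3 / 4) 0) (pt (-1) (-1) 0) ∪
  segment ℝ (pt (1 / 4) (-3 / 4) 0) (pt 1 (-1) 0)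

theorem norm_pt_le {x y z : ℝ} (h : x ^ 2 + y ^ 2 + z ^ 2 ≤ 2) : ‖pt x y z‖ ≤ Real.sqrt 2 :=
  norm_le_sqrt_two_iff.2 h

theorem norm_pt_le_half {x y z : ℝ} (h : x ^ 2 + y ^ 2 + z ^ 2 ≤ 1 / 4) :
    ‖pt x y z‖ ≤ 1 / 2 := by
  refine abs_le_of_sq_le_sq' ?_ (by norm_num) |>.2
  rw [norm_sq_coords]
  simp only [pt_zero, pt_one, pt_two]
  linarith

theorem toSpace_add (T S : Set B3) : toSpace (add T S) =
    quarter (pt (-1 / 2) 0 0) '' toSpace T ∪ quarter (pt (1 / 2) 0 0) '' toSpace S ∪ addFrame := by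
  simp only [add, toSpace_union, addFrame]
  rw [toSpace_place (norm_pt_le_half (by norm_num)), toSpace_place (norm_pt_le_half (by norm_num))]
  repeat rw [toSpace_seg (norm_pt_le (by norm_num)) (norm_pt_le (by norm_num))]

theorem toSpace_mul (T S : Set B3) : toSpace (mul T S) =
    quarter (pt 0 (1 / 2) 0) '' toSpace T ∪ quarter (pt 0 (-1 / 2) 0) '' toSpace S ∪ mulFrame := by
  simp only [mul, toSpace_union, mulFrame]
  rw [toSpace_place (norm_pt_le_half (by norm_num)), toSpace_place (norm_pt_le_half (by norm_num))]
  repeat rw [toSpace_seg (norm_pt_le (by norm_num)) (norm_pt_le (by norm_num))]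

/-- A single crossing, as a set of points of space. -/
theorem toSpace_crossing {ε : ℝ} (hε : ε ^ 2 = 1) : toSpace (crossing ε) =
    (segment ℝ (pt (-1) 1 0) (pt 0 0 ε) ∪ segment ℝ (pt 0 0 ε) (pt 1 (-1) 0)) ∪
    (segment ℝ (pt (-1) (-1) 0) (pt 0 0 (-ε)) ∪ segment ℝ (pt 0 0 (-ε)) (pt 1 1 0)) := by
  simp only [crossing, toSpace_union]
  repeat rw [toSpace_seg (norm_pt_le (by norm_num [hε])) (norm_pt_le (by norm_num [hε]))]

theorem toSpace_zero : toSpace zero =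
    segment ℝ (pt (-1) 1 0) (pt 1 1 0) ∪ segment ℝ (pt (-1) (-1) 0) (pt 1 (-1) 0) := by
  simp only [zero, toSpace_union]
  repeat rw [toSpace_seg (norm_pt_le (by norm_num)) (norm_pt_le (by norm_num))]

theorem toSpace_infty : toSpace infty =
    segment ℝ (pt (-1) 1 0) (pt (-1) (-1) 0) ∪ segment ℝ (pt 1 1 0) (pt 1 (-1) 0) := by
  simp only [infty, toSpace_union]
  repeat rw [toSpace_seg (norm_pt_le (by norm_num)) (norm_pt_le (by norm_num))]

/-! ### Symmetries of space -/

/-- The image of a tangle under a linear isometry of space. -/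
def act (g : E3 ≃ₗᵢ[ℝ] E3) (T : Set B3) : Set B3 := {p | ∃ q ∈ T, p.1 = g q.1}

theorem toSpace_act (g : E3 ≃ₗᵢ[ℝ] E3) (T : Set B3) : toSpace (act g T) = g '' toSpace T := by
  have h : ∀ p, (∃ q ∈ T, p = g q.1) → ‖p‖ ≤ Real.sqrt 2 := by
    rintro _ ⟨q, _, rfl⟩
    rw [g.norm_map]
    exact norm_coe_le q
  rw [act, toSpace_setOf (P := fun p => ∃ q ∈ T, p = g q.1) h]
  ext p
  simp only [Set.mem_ofPred_eq, Set.mem_image, exists_mem_toSpace (P := fun q => g q = p)]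
  simp only [eq_comm]

theorem act_act (g h : E3 ≃ₗᵢ[ℝ] E3) (T : Set B3) : act g (act h T) = act (h.trans g) T := by
  refine toSpace_injective ?_
  simp only [toSpace_act, Set.image_image]
  rfl

theorem Supported.conj {f : E3 → E3} (hf : Supported f) (g : E3 ≃ₗᵢ[ℝ] E3) :
    Supported fun p => g (f (g.symm p)) where
  continuous := g.continuous.comp (hf.continuous.comp g.symm.continuous)
  bijective := g.bijective.comp (hf.bijective.comp g.symm.bijective)
  eq_self p hp := by rw [hf.eq_self _ (by rwa [g.symm.norm_map]), g.apply_symm_apply]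

theorem Isotopic.act {T S : Set B3} (h : Isotopic T S) (g : E3 ≃ₗᵢ[ℝ] E3) :
    Isotopic (act g T) (act g S) := by
  obtain ⟨f, hf, hfT⟩ := h.exists_supported
  refine (hf.conj g).isotopic ?_
  rw [toSpace_act, toSpace_act, ← hfT]
  simp [Set.image_image]

theorem image_quarter (g : E3 ≃ₗᵢ[ℝ] E3) (c : E3) (A : Set E3) :
    g '' (quarter c '' A) = quarter (g c) '' (g '' A) := by
  simp only [Set.image_image, quarter, map_add, map_smul]

theorem image_segment' (g : E3 ≃ₗᵢ[ℝ] E3) (p q : E3) :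
    g '' segment ℝ p q = segment ℝ (g p) (g q) :=
  image_segment ℝ (g.toLinearEquiv : E3 →ₗ[ℝ] E3).toAffineMap p q

/-- The symmetry of space which multiplies the coordinates by given signs. -/
noncomputable def signs (a b c : ℝ) (ha : a ^ 2 = 1) (hb : b ^ 2 = 1) (hc : c ^ 2 = 1) :
    E3 ≃ₗᵢ[ℝ] E3 where
  toFun p := pt (a * p 0) (b * p 1) (c * p 2)
  invFun p := pt (a * p 0) (b * p 1) (c * p 2)
  map_add' p q := by apply ext_coords <;> simp [mul_add]
  map_smul' t p := by apply ext_coords <;> simp [mul_left_comm]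
  left_inv p := by
    apply ext_coords <;> simp only [pt_zero, pt_one, pt_two, ← mul_assoc, ← sq, ha, hb, hc, one_mul]
  right_inv p := by
    apply ext_coords <;> simp only [pt_zero, pt_one, pt_two, ← mul_assoc, ← sq, ha, hb, hc, one_mul]
  norm_map' p := by
    refine norm_eq_of_coords ?_
    change (a * p 0) ^ 2 + (b * p 1) ^ 2 + (c * p 2) ^ 2 = _
    simp only [mul_pow, ha, hb, hc, one_mul]

theorem signs_apply {a b c : ℝ} (ha : a ^ 2 = 1) (hb : b ^ 2 = 1) (hc : c ^ 2 = 1) (p : E3) :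
    signs a b c ha hb hc p = pt (a * p 0) (b * p 1) (c * p 2) := rfl

/-- Rotation by 180° around the horizontal axis. -/
noncomputable def hRot : E3 ≃ₗᵢ[ℝ] E3 :=
  signs 1 (-1) (-1) (by norm_num) (by norm_num) (by norm_num)

/-- Rotation by 180° around the vertical axis. -/
noncomputable def vRot : E3 ≃ₗᵢ[ℝ] E3 :=
  signs (-1) 1 (-1) (by norm_num) (by norm_num) (by norm_num)

/-- Reflection in the plane of the diagrams. -/
noncomputable def zRefl : E3 ≃ₗᵢ[ℝ] E3 :=
  signs 1 1 (-1) (by norm_num) (by norm_num) (by norm_num)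

/-- Counterclockwise rotation by 90° of the plane of the diagrams. -/
noncomputable def ccw : E3 ≃ₗᵢ[ℝ] E3 where
  toFun p := pt (-p 1) (p 0) (p 2)
  invFun p := pt (p 1) (-p 0) (p 2)
  map_add' p q := by apply ext_coords <;> simp [add_comm]
  map_smul' t p := by apply ext_coords <;> simp
  left_inv p := by apply ext_coords <;> simp
  right_inv p := by apply ext_coords <;> simp
  norm_map' p := by
    refine norm_eq_of_coords ?_
    change (-p 1) ^ 2 + p 0 ^ 2 + p 2 ^ 2 = _
    ring

theorem hRot_apply (p : E3) : hRot p = pt (p 0) (-p 1) (-p 2) := by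
  simp [hRot, signs_apply]

theorem vRot_apply (p : E3) : vRot p = pt (-p 0) (p 1) (-p 2) := by
  simp [vRot, signs_apply]

theorem zRefl_apply (p : E3) : zRefl p = pt (p 0) (p 1) (-p 2) := by
  simp [zRefl, signs_apply]

theorem ccw_apply (p : E3) : ccw p = pt (-p 1) (p 0) (p 2) := rfl

theorem hRot_pt (x y z : ℝ) : hRot (pt x y z) = pt x (-y) (-z) := hRot_apply _

theorem vRot_pt (x y z : ℝ) : vRot (pt x y z) = pt (-x) y (-z) := vRot_apply _

theorem ccw_pt (x y z : ℝ) : ccw (pt x y z) = pt (-y) x z := rfl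

theorem ccw_symm_apply (p : E3) : ccw.symm p = pt (p 1) (-p 0) (p 2) := rfl

theorem hflip_eq_act (T : Set B3) : hflip T = act hRot T := by
  simp only [hflip, act, hRot_apply]

theorem vflip_eq_act (T : Set B3) : vflip T = act vRot T := by
  simp only [vflip, act, vRot_apply]

theorem mirror_eq_act (T : Set B3) : mirror T = act zRefl T := by
  simp only [mirror, act, zRefl_apply]

theorem rot_eq_act (T : Set B3) : rot T = act ccw T := rfl

theorem rotCW_eq_act (T : Set B3) : rotCW T = act ccw.symm T := rfl

/-! ### Symmetries and the operations on tangles -/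

theorem hflip_add (T S : Set B3) : hflip (add T S) = add (hflip T) (hflip S) := by
  refine toSpace_injective ?_
  simp only [hflip_eq_act, toSpace_act, toSpace_add, Set.image_union, image_quarter, addFrame,
    image_segment', hRot_pt, neg_zero, neg_neg, ← neg_div]
  ac_rfl

theorem vflip_add (T S : Set B3) : vflip (add T S) = add (vflip S) (vflip T) := by
  refine toSpace_injective ?_
  simp only [vflip_eq_act, toSpace_act, toSpace_add, Set.image_union, image_quarter, addFrame,
    image_segment', vRot_pt, neg_zero, neg_neg, ← neg_div]
  rw [segment_symm ℝ (pt 1 1 0), segment_symm ℝ (pt 1 (-1) 0),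
    segment_symm ℝ (pt (-3 / 4) (1 / 4) 0), segment_symm ℝ (pt (-3 / 4) (-1 / 4) 0),
    segment_symm ℝ (pt (1 / 4) (1 / 4) 0), segment_symm ℝ (pt (1 / 4) (-1 / 4) 0)]
  ac_rfl

/-- Reduces every statement about products to one about sums. -/
theorem rot_mul (T S : Set B3) : rot (mul T S) = add (rot T) (rot S) := by
  refine toSpace_injective ?_
  simp only [rot_eq_act, toSpace_act, toSpace_add, toSpace_mul, Set.image_union, image_quarter,
    addFrame, mulFrame, image_segment', ccw_pt, neg_neg,
    ← neg_div]
  ac_rfl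

/-- The half turn exchanges the two arcs: it swaps the two diagonals and also the heights `ε` and
`-ε`. -/
theorem hflip_crossing {ε : ℝ} (hε : ε ^ 2 = 1) : hflip (crossing ε) = crossing ε := by
  refine toSpace_injective ?_
  simp only [hflip_eq_act, toSpace_act, toSpace_crossing hε, Set.image_union,
    image_segment', hRot_pt, neg_zero, neg_neg]
  ac_rfl

theorem vflip_crossing {ε : ℝ} (hε : ε ^ 2 = 1) : vflip (crossing ε) = crossing ε := by
  refine toSpace_injective ?_
  simp only [vflip_eq_act, toSpace_act, toSpace_crossing hε, Set.image_union,
    image_segment', vRot_pt, neg_zero, neg_neg]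
  rw [segment_symm ℝ (pt 1 1 0), segment_symm ℝ (pt 1 (-1) 0), segment_symm ℝ _ (pt (-1) (-1) 0),
    segment_symm ℝ _ (pt (-1) 1 0)]
  ac_rfl

/-- A quarter turn swaps the two diagonals but keeps heights, hence the change of sign. -/
theorem rot_crossing {ε : ℝ} (hε : ε ^ 2 = 1) : rot (crossing ε) = crossing (-ε) := by
  refine toSpace_injective ?_
  rw [toSpace_crossing (by rwa [neg_sq])]
  simp only [rot_eq_act, toSpace_act, toSpace_crossing hε, Set.image_union,
    image_segment', ccw_pt, neg_zero, neg_neg]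
  rw [segment_symm ℝ (pt 1 (-1) 0), segment_symm ℝ _ (pt (-1) 1 0)]
  ac_rfl

theorem hflip_zero : hflip zero = zero := by
  refine toSpace_injective ?_
  simp only [hflip_eq_act, toSpace_act, toSpace_zero, Set.image_union,
    image_segment', hRot_pt, neg_zero, neg_neg]
  ac_rfl

theorem vflip_zero : vflip zero = zero := by
  refine toSpace_injective ?_
  simp only [vflip_eq_act, toSpace_act, toSpace_zero, Set.image_union,
    image_segment', vRot_pt, neg_zero, neg_neg]
  rw [segment_symm ℝ (pt 1 1 0), segment_symm ℝ (pt 1 (-1) 0)]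

theorem rot_infty : rot infty = zero := by
  refine toSpace_injective ?_
  simp only [rot_eq_act, toSpace_act, toSpace_infty, toSpace_zero, Set.image_union,
    image_segment', ccw_pt, neg_neg]
  exact Set.union_comm _ _

/-! ### Sums of isotopic tangles -/

theorem Supported.quarter_conj {f : E3 → E3} (hf : Supported f) {c : E3} (hc : ‖c‖ ≤ 1 / 2) :
    Supported fun p => quarter c (f ((4 : ℝ) • (p - c))) where
  continuous := by
    have := hf.continuous
    unfold quarter
    fun_prop
  bijective := by
    have h1 : Function.Bijective (quarter c) :=
      (AddGroup.addLeft_bijective c).comp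
        (MulAction.bijective₀ (by norm_num : (1 / 4 : ℝ) ≠ 0))
    have h2 : Function.Bijective fun p : E3 => (4 : ℝ) • (p - c) :=
      (MulAction.bijective₀ (by norm_num : (4 : ℝ) ≠ 0)).comp (Equiv.subRight c).bijective
    exact h1.comp (hf.bijective.comp h2)
  eq_self p hp := by
    rw [hf.eq_self]
    · simp [quarter, smul_smul]
    · rw [norm_smul, Real.norm_eq_abs, abs_of_pos (by norm_num : (0 : ℝ) < 4)]
      have h1 := norm_sub_norm_le p c
      have h3 : 1 ≤ Real.sqrt 2 := Real.one_le_sqrt.2 (by norm_num)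
      linarith

/-- The homeomorphism for `T` is transplanted into the small left ball. All other pieces of the sum
lie outside the interior of that ball and are fixed. -/
theorem Isotopic.add_right {T T' : Set B3} (h : Isotopic T T') (S : Set B3) :
    Isotopic (add T S) (add T' S) := by
  obtain ⟨f, hf, hfT⟩ := h.exists_supported
  set c := pt (-1 / 2) 0 0 with hc
  have hc' : ‖c‖ ≤ 1 / 2 := norm_pt_le_half (by norm_num)
  -- The small ball has radius `√2 / 4`, whose square is `1 / 8`.
  have hfix : ∀ p : E3, 1 / 8 ≤ (p 0 + 1 / 2) ^ 2 + p 1 ^ 2 + p 2 ^ 2 →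
      quarter c (f ((4 : ℝ) • (p - c))) = p := by
    intro p hp
    rw [hf.eq_self]
    · simp [quarter, smul_smul]
    · rw [sqrt_two_le_norm_iff]
      simp only [PiLp.smul_apply, PiLp.sub_apply, hc, pt_zero, pt_one, pt_two, smul_eq_mul]
      nlinarith
  have himg : ∀ A : Set E3, (∀ p ∈ A, 1 / 8 ≤ (p 0 + 1 / 2) ^ 2 + p 1 ^ 2 + p 2 ^ 2) →
      (fun p => quarter c (f ((4 : ℝ) • (p - c)))) '' A = A := by
    intro A hA
    conv_rhs => rw [← Set.image_id A]
    exact Set.image_congr fun p hp => hfix p (hA p hp)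
  -- Along each joining arc both `|x + 1/2|` and `|y|` are at least `1/4`, and `1/16 + 1/16 = 1/8`.
  have hseg : ∀ x y x' y' : ℝ, (x ≤ -3 / 4 ∧ x' ≤ -3 / 4 ∨ -1 / 4 ≤ x ∧ -1 / 4 ≤ x') →
      (y ≤ -1 / 4 ∧ y' ≤ -1 / 4 ∨ 1 / 4 ≤ y ∧ 1 / 4 ≤ y') →
      ∀ p ∈ segment ℝ (pt x y 0) (pt x' y' 0),
      1 / 8 ≤ (p 0 + 1 / 2) ^ 2 + p 1 ^ 2 + p 2 ^ 2 := by
    rintro x y x' y' hx hy p ⟨a, b, ha, hb, hab, rfl⟩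
    simp only [PiLp.smul_apply, PiLp.add_apply, pt_zero, pt_one, pt_two, smul_eq_mul]
    have e1 : 1 / 16 ≤ (a * x + b * x' + 1 / 2) ^ 2 := by
      rcases hx with ⟨h1, h2⟩ | ⟨h1, h2⟩
      · have : a * x + b * x' ≤ -3 / 4 := by nlinarith
        nlinarith
      · have : -1 / 4 ≤ a * x + b * x' := by nlinarith
        nlinarith
    have e2 : 1 / 16 ≤ (a * y + b * y') ^ 2 := by
      rcases hy with ⟨h1, h2⟩ | ⟨h1, h2⟩
      · have : a * y + b * y' ≤ -1 / 4 := by nlinarith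
        nlinarith
      · have : 1 / 4 ≤ a * y + b * y' := by nlinarith
        nlinarith
    nlinarith
  refine (hf.quarter_conj hc').isotopic ?_
  rw [toSpace_add, toSpace_add, ← hc, Set.image_union, Set.image_union, ← hfT]
  congr 1
  · congr 1
    · simp [Set.image_image, quarter, smul_smul]
    · refine himg _ ?_
      rintro _ ⟨_, ⟨q, _, rfl⟩, rfl⟩
      have hq := norm_le_sqrt_two_iff.1 (norm_coe_le q)
      simp only [quarter, PiLp.smul_apply, PiLp.add_apply, pt_zero, pt_one, pt_two, smul_eq_mul]
      have : -2 ≤ q.1 0 := by nlinarith [sq_nonneg (q.1 1), sq_nonneg (q.1 2)]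
      nlinarith [sq_nonneg (q.1 1), sq_nonneg (q.1 2)]
  · refine himg _ ?_
    rintro p (((((hp | hp) | hp) | hp) | hp) | hp) <;>
      exact hseg _ _ _ _ (by norm_num) (by norm_num) p hp

/-! ### Cylindrical coordinates around the horizontal axis -/

/-- The point with coordinate `x` on the horizontal axis and transversal coordinates `w`. -/
noncomputable def cyl (x : ℝ) (w : ℂ) : E3 := pt x w.re w.im

/-- The coordinates transversal to the horizontal axis, as a complex number. -/
def tr (p : E3) : ℂ := ⟨p 1, p 2⟩

@[simp] theorem cyl_zero (x : ℝ) (w : ℂ) : cyl x w 0 = x := rfl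

@[simp] theorem tr_cyl (x : ℝ) (w : ℂ) : tr (cyl x w) = w := rfl

theorem cyl_eta (p : E3) : cyl (p 0) (tr p) = p := pt_eta p

theorem tr_add (p q : E3) : tr (p + q) = tr p + tr q := rfl

theorem tr_smul (t : ℝ) (p : E3) : tr (t • p) = t • tr p := by
  apply Complex.ext <;> simp [tr]

theorem continuous_cyl {X : Type*} [TopologicalSpace X] {f : X → ℝ} {g : X → ℂ}
    (hf : Continuous f) (hg : Continuous g) : Continuous fun a => cyl (f a) (g a) :=
  continuous_pt hf (Complex.continuous_re.comp hg) (Complex.continuous_im.comp hg)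

theorem continuous_coord (i : Fin 3) : Continuous fun p : E3 => p i := by fun_prop

theorem continuous_tr : Continuous tr := by
  have : Continuous fun p : E3 => Complex.equivRealProdCLM.symm (p 1, p 2) := by fun_prop
  exact this

theorem norm_sq_cyl (p : E3) : ‖p‖ ^ 2 = p 0 ^ 2 + ‖tr p‖ ^ 2 := by
  rw [norm_sq_coords, ← Complex.normSq_eq_norm_sq, Complex.normSq_apply]
  simp only [tr]
  ring

/-- The cylinder `|x| < 1`, `‖w‖ < 1` lies in the open ball, so a map that is the identity off the
cylinder is the identity off the ball. -/
theorem one_le_of_sqrt_two_le {p : E3} (hp : Real.sqrt 2 ≤ ‖p‖) : 1 ≤ |p 0| ∨ 1 ≤ ‖tr p‖ := by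
  rw [Real.sqrt_le_left (norm_nonneg _), norm_sq_cyl] at hp
  by_contra! h
  have h1 := (sq_lt_one_iff_abs_lt_one (p 0)).2 h.1
  have h2 : ‖tr p‖ ^ 2 < 1 := by nlinarith [norm_nonneg (tr p), h.2]
  linarith

/-- The map which moves points radially in the planes perpendicular to the axis. -/
noncomputable def radial (G : ℝ → ℝ → ℝ) (p : E3) : E3 :=
  cyl (p 0) ((G (p 0) ‖tr p‖ / ‖tr p‖) • tr p)

/-- The map which moves points parallel to the axis. -/
noncomputable def slide (F : ℝ → ℝ → ℝ) (p : E3) : E3 := cyl (F (p 0) ‖tr p‖) (tr p)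

/-- The map which rotates points around the axis. -/
noncomputable def twist (l : ℝ → ℝ → ℂ) (p : E3) : E3 := cyl (p 0) (l (p 0) ‖tr p‖ * tr p)

/-- Each line parallel to the axis is mapped to itself, so bijectivity is a one-variable matter:
strict monotonicity, and the intermediate value theorem starting from a fixed point to the left of
the ball's central cylinder. -/
theorem supported_slide {F : ℝ → ℝ → ℝ} (hc : Continuous fun a : ℝ × ℝ => F a.1 a.2)
    (hm : ∀ r, StrictMono fun x => F x r) (hge : ∀ x r, x ≤ F x r)
    (h1 : ∀ x r, 1 ≤ |x| ∨ 1 ≤ r → F x r = x) : Supported (slide F) where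
  continuous := continuous_cyl
    (hc.comp ((continuous_coord 0).prodMk continuous_tr.norm)) continuous_tr
  bijective := by
    constructor
    · intro p q h
      have h2 : tr p = tr q := by
        simpa only [slide, tr_cyl, cyl_zero] using congrArg tr h
      have h0 : F (p 0) ‖tr p‖ = F (q 0) ‖tr q‖ := by
        simpa only [slide, tr_cyl, cyl_zero] using congrArg (fun r : E3 => r 0) h
      rw [h2] at h0
      rw [← cyl_eta p, ← cyl_eta q, h2, (hm _).injective h0]
    · intro p
      set r := ‖tr p‖
      set a := min (p 0) (-1)
      have ha : F a r = a := h1 _ _ (Or.inl (by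
        rw [le_abs]
        right
        linarith [min_le_right (p 0) (-1)]))
      have hcr : Continuous fun x => F x r := hc.comp (by fun_prop : Continuous fun x => (x, r))
      obtain ⟨x, -, hx⟩ := intermediate_value_Icc (min_le_left (p 0) (-1)) hcr.continuousOn
        (show p 0 ∈ Set.Icc (F a r) (F (p 0) r) from ⟨ha.trans_le (min_le_left _ _), hge _ _⟩)
      exact ⟨cyl x (tr p), (congrArg₂ cyl hx rfl).trans (cyl_eta p)⟩
  eq_self p hp := by
    rw [slide, h1 _ _ (one_le_of_sqrt_two_le hp), cyl_eta]

/-- The rotation factor depends only on `x` and the radius, both of which are preserved, so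
multiplying by its inverse undoes the map. -/
theorem supported_twist {l : ℝ → ℝ → ℂ} (hc : Continuous fun a : ℝ × ℝ => l a.1 a.2)
    (hl : ∀ x r, ‖l x r‖ = 1) (h1 : ∀ x r, 1 ≤ |x| ∨ 1 ≤ r → l x r = 1) :
    Supported (twist l) where
  continuous := continuous_cyl (continuous_coord 0)
    ((hc.comp ((continuous_coord 0).prodMk continuous_tr.norm)).mul continuous_tr)
  bijective := by
    have hne : ∀ x r, l x r ≠ 0 := fun x r h => by simpa [h] using hl x r
    constructor
    · intro p q h
      have h0 : p 0 = q 0 := by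
        simpa only [twist, tr_cyl, cyl_zero] using congrArg (fun r : E3 => r 0) h
      have h2 : l (p 0) ‖tr p‖ * tr p = l (q 0) ‖tr q‖ * tr q := by
        simpa only [twist, tr_cyl, cyl_zero] using congrArg tr h
      have h3 : ‖tr p‖ = ‖tr q‖ := by simpa [hl] using congrArg norm h2
      rw [h0, h3] at h2
      rw [← cyl_eta p, ← cyl_eta q, h0, mul_left_cancel₀ (hne _ _) h2]
    · intro p
      refine ⟨cyl (p 0) ((l (p 0) ‖tr p‖)⁻¹ * tr p), ?_⟩
      simp [twist, hl, hne, cyl_eta]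
  eq_self p hp := by
    rw [twist, h1 _ _ (one_le_of_sqrt_two_le hp), one_mul, cyl_eta]

/-- Each half-line issuing perpendicularly from the axis is mapped to itself by `G x`. On the axis
the quotient is `0 / 0 = 0`; continuity there comes from the image having norm `G x r`, which tends
to `G x 0 = 0`. -/
theorem supported_radial {G : ℝ → ℝ → ℝ} (hc : Continuous fun a : ℝ × ℝ => G a.1 a.2)
    (h0 : ∀ x, G x 0 = 0) (hm : ∀ x, StrictMono (G x)) (hge : ∀ x r, r ≤ G x r)
    (h1 : ∀ x r, 1 ≤ |x| ∨ 1 ≤ r → G x r = r) : Supported (radial G) where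
  continuous := by
    refine continuous_cyl (continuous_coord 0) ?_
    have hG : Continuous fun p : E3 => G (p 0) ‖tr p‖ :=
      hc.comp ((continuous_coord 0).prodMk continuous_tr.norm)
    rw [continuous_iff_continuousAt]
    intro p
    by_cases hp : tr p = 0
    · rw [ContinuousAt, hp, smul_zero]
      refine squeeze_zero_norm (a := fun p : E3 => |G (p 0) ‖tr p‖|) (fun q => ?_) ?_
      · rw [norm_smul, Real.norm_eq_abs, abs_div, abs_norm]
        by_cases hq : ‖tr q‖ = 0
        · simp [hq]
        · rw [div_mul_cancel₀ _ hq]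
      · simpa [hp, h0] using hG.abs.tendsto p
    · exact (hG.continuousAt.div continuous_tr.norm.continuousAt (norm_ne_zero_iff.2 hp)).smul
        continuous_tr.continuousAt
  bijective := by
    have hnn : ∀ x (w : ℂ), 0 ≤ G x ‖w‖ := fun x w => (norm_nonneg w).trans (hge _ _)
    have hnorm : ∀ x (w : ℂ), ‖(G x ‖w‖ / ‖w‖) • w‖ = G x ‖w‖ := by
      intro x w
      by_cases hw : w = 0
      · simp [hw, h0]
      · rw [norm_smul, Real.norm_eq_abs, abs_of_nonneg (div_nonneg (hnn _ _) (norm_nonneg _)),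
          div_mul_cancel₀ _ (norm_ne_zero_iff.2 hw)]
    constructor
    · intro p q h
      have e0 : p 0 = q 0 := by
        simpa only [radial, tr_cyl, cyl_zero] using congrArg (fun r : E3 => r 0) h
      have e2 : (G (p 0) ‖tr p‖ / ‖tr p‖) • tr p = (G (q 0) ‖tr q‖ / ‖tr q‖) • tr q :=
        by simpa only [radial, tr_cyl, cyl_zero] using congrArg tr h
      have e3 : ‖tr p‖ = ‖tr q‖ := by
        have := congrArg norm e2
        rw [hnorm, hnorm, e0] at this
        exact (hm _).injective this
      rw [← cyl_eta p, ← cyl_eta q, e0]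
      congr 1
      by_cases hq : tr q = 0
      · rw [hq, norm_zero, norm_eq_zero] at e3
        rw [e3, hq]
      · have hq' : 0 < ‖tr q‖ := norm_pos_iff.2 hq
        have hpos : 0 < G (q 0) ‖tr q‖ / ‖tr q‖ := div_pos (hq'.trans_le (hge _ _)) hq'
        rw [e0, e3] at e2
        exact (smul_right_injective ℂ hpos.ne') e2
    · intro p
      by_cases hp : tr p = 0
      · refine ⟨p, ?_⟩
        conv_rhs => rw [← cyl_eta p]
        rw [radial, hp, smul_zero]
      · have hp' : 0 < ‖tr p‖ := norm_pos_iff.2 hp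
        have hcx : Continuous (G (p 0)) := hc.comp (by fun_prop : Continuous fun r => (p 0, r))
        obtain ⟨r, hr, hGr⟩ := intermediate_value_Icc (norm_nonneg (tr p)) hcx.continuousOn
          (show ‖tr p‖ ∈ Set.Icc (G (p 0) 0) (G (p 0) ‖tr p‖) from
            ⟨(h0 _).trans_le (norm_nonneg _), hge _ _⟩)
        have hr0 : 0 < r := by
          refine lt_of_le_of_ne hr.1 fun h => ?_
          rw [← h, h0] at hGr
          exact hp'.ne hGr
        refine ⟨cyl (p 0) ((r / ‖tr p‖) • tr p), ?_⟩
        have hn : ‖(r / ‖tr p‖) • tr p‖ = r := by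
          rw [norm_smul, Real.norm_eq_abs, abs_of_pos (div_pos hr0 hp'),
            div_mul_cancel₀ _ hp'.ne']
        rw [radial, tr_cyl, cyl_zero, hn, hGr, smul_smul, div_mul_div_cancel₀ hr0.ne',
          div_self hp'.ne', one_smul, cyl_eta]
  eq_self p hp := by
    rw [radial, h1 _ _ (one_le_of_sqrt_two_le hp)]
    by_cases hp : tr p = 0
    · rw [hp, smul_zero, ← hp, cyl_eta]
    · rw [div_self (norm_ne_zero_iff.2 hp), one_smul, cyl_eta]

/-! ### The strands of a sum with a crossing -/

/-- One of the two strands to the right of `T` in `T + [ε]`, in transversal coordinates. The other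
one is its negative. -/
noncomputable def strand (ε x : ℝ) : ℂ :=
  ⟨min (1 / 4) (min (1 / 2 - x) (2 - 3 * x)), ε * max 0 (1 / 4 - |x - 1 / 2|)⟩

theorem strand_of_le (ε : ℝ) {x : ℝ} (h : x ≤ 1 / 4) : strand ε x = ⟨1 / 4, 0⟩ := by
  rw [strand, min_eq_left (le_min (by linarith) (by linarith)), max_eq_left, mul_zero]
  linarith [neg_le_abs (x - 1 / 2)]

theorem strand_of_ge (ε : ℝ) {x : ℝ} (h : 3 / 4 ≤ x) : strand ε x = ⟨2 - 3 * x, 0⟩ := by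
  rw [strand, min_eq_right (b := 2 - 3 * x) (by linarith), min_eq_right (by linarith),
    max_eq_left, mul_zero]
  linarith [le_abs_self (x - 1 / 2)]

theorem strand_of_mem_left (ε : ℝ) {x : ℝ} (h : 1 / 4 ≤ x) (h' : x ≤ 1 / 2) :
    strand ε x = ⟨1 / 2 - x, ε * (x - 1 / 4)⟩ := by
  rw [strand, min_eq_left (b := 2 - 3 * x) (by linarith), min_eq_right (by linarith),
    abs_of_nonpos (by linarith), max_eq_right (by linarith)]
  congr 2
  ring

theorem strand_of_mem_right (ε : ℝ) {x : ℝ} (h : 1 / 2 ≤ x) (h' : x ≤ 3 / 4) :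
    strand ε x = ⟨1 / 2 - x, ε * (3 / 4 - x)⟩ := by
  rw [strand, min_eq_left (b := 2 - 3 * x) (by linarith), min_eq_right (by linarith),
    abs_of_nonneg (by linarith), max_eq_right (by linarith)]
  congr 2
  ring

theorem continuous_strand (ε : ℝ) : Continuous (strand ε) := by
  have : Continuous fun x : ℝ => Complex.equivRealProdCLM.symm
    (min (1 / 4) (min (1 / 2 - x) (2 - 3 * x)), ε * max 0 (1 / 4 - |x - 1 / 2|)) := by fun_prop
  exact this

theorem norm_real_mk {a : ℝ} : ‖(⟨a, 0⟩ : ℂ)‖ = |a| := Complex.norm_real a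

theorem norm_strand_of_le (ε : ℝ) {x : ℝ} (h : x ≤ 1 / 4) : ‖strand ε x‖ = 1 / 4 := by
  rw [strand_of_le ε h, norm_real_mk]
  norm_num

theorem norm_strand_of_ge (ε : ℝ) {x : ℝ} (h : 3 / 4 ≤ x) : ‖strand ε x‖ = 3 * x - 2 := by
  rw [strand_of_ge ε h, norm_real_mk, abs_of_neg (by linarith)]
  ring

/-- Within the crossing the strand runs along the square `|y| + |z| = 1/4`, whose distance from the
axis is `√2 / 8 > 1/6`. The strand thus never meets the axis and its direction is defined. -/
theorem norm_mk_mem_Icc {ε a b : ℝ} (hε : ε ^ 2 = 1) (h : |a| + b = 1 / 4) (hb : 0 ≤ b) :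
    ‖(⟨a, ε * b⟩ : ℂ)‖ ∈ Set.Icc (1 / 6 : ℝ) (1 / 4) := by
  have h1 : ‖(⟨a, ε * b⟩ : ℂ)‖ ^ 2 = |a| ^ 2 + b ^ 2 := by
    rw [← Complex.normSq_eq_norm_sq, Complex.normSq_mk, sq_abs]
    linear_combination b ^ 2 * hε
  have h0 := norm_nonneg (⟨a, ε * b⟩ : ℂ)
  have ha := abs_nonneg a
  constructor
  · nlinarith [sq_nonneg (|a| - b)]
  · nlinarith [mul_nonneg ha hb]

theorem norm_strand_of_mem {ε x : ℝ} (hε : ε ^ 2 = 1) (h : 1 / 4 ≤ x) (h' : x ≤ 3 / 4) :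
    ‖strand ε x‖ ∈ Set.Icc (1 / 6 : ℝ) (1 / 4) := by
  rcases le_total x (1 / 2) with hx | hx
  · rw [strand_of_mem_left ε h hx]
    refine norm_mk_mem_Icc hε ?_ (by linarith)
    rw [abs_of_nonneg (by linarith)]
    ring
  · rw [strand_of_mem_right ε hx h']
    refine norm_mk_mem_Icc hε ?_ (by linarith)
    rw [abs_of_nonpos (by linarith)]
    ring

theorem one_sixth_le_norm_strand {ε : ℝ} (hε : ε ^ 2 = 1) (x : ℝ) : 1 / 6 ≤ ‖strand ε x‖ := by
  rcases le_total x (1 / 4) with h | h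
  · rw [norm_strand_of_le ε h]
    norm_num
  · rcases le_total x (3 / 4) with h' | h'
    · exact (norm_strand_of_mem hε h h').1
    · rw [norm_strand_of_ge ε h']
      linarith

theorem norm_strand_pos {ε : ℝ} (hε : ε ^ 2 = 1) (x : ℝ) : 0 < ‖strand ε x‖ :=
  lt_of_lt_of_le (by norm_num) (one_sixth_le_norm_strand hε x)

theorem norm_strand_le {ε x : ℝ} (hε : ε ^ 2 = 1) (h' : x ≤ 3 / 4) : ‖strand ε x‖ ≤ 1 / 4 := by
  rcases le_total x (1 / 4) with h | h
  · rw [norm_strand_of_le ε h]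
  · exact (norm_strand_of_mem hε h h').2

/-- The curve `x ↦ (x, σ w(x))` in cylindrical coordinates, over the interval `[a, b]`. -/
noncomputable def graph (w : ℝ → ℂ) (a b σ : ℝ) : Set E3 :=
  (fun x => cyl x (σ • w x)) '' Set.Icc a b

/-- The hypothesis `hw` is affinity of `w` on `[a, b]`, cleared of denominators. -/
theorem segment_eq_graph {a b σ : ℝ} (hab : a < b) {w : ℝ → ℂ} {p q : E3}
    (hp : p = cyl a (σ • w a)) (hq : q = cyl b (σ • w b))
    (hw : ∀ x ∈ Set.Icc a b, (b - a) • w x = (b - x) • w a + (x - a) • w b) :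
    segment ℝ p q = graph w a b σ := by
  have hpos : 0 < b - a := sub_pos.2 hab
  have key : ∀ s t : ℝ, s + t = 1 → s * a + t * b ∈ Set.Icc a b →
      s • p + t • q = cyl (s * a + t * b) (σ • w (s * a + t * b)) := by
    intro s t hst hx
    have e : w (s * a + t * b) = s • w a + t • w b := by
      have h := hw _ hx
      rw [show b - (s * a + t * b) = (b - a) * s by rw [← eq_sub_iff_add_eq] at hst; rw [hst]; ring,
        show s * a + t * b - a = (b - a) * t by rw [← eq_sub_iff_add_eq] at hst; rw [hst]; ring,
        mul_smul, mul_smul, ← smul_add] at h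
      exact smul_right_injective ℂ hpos.ne' h
    rw [e, hp, hq]
    apply ext_coords <;> simp [cyl] <;> ring
  ext r
  constructor
  · rintro ⟨s, t, hs, ht, hst, rfl⟩
    have hx : s * a + t * b ∈ Set.Icc a b := by
      obtain rfl : s = 1 - t := by linarith
      constructor <;> nlinarith [mul_nonneg hs hpos.le, mul_nonneg ht hpos.le]
    exact ⟨_, hx, (key s t hst hx).symm⟩
  · rintro ⟨x, hx, rfl⟩
    have e : (b - x) / (b - a) * a + (x - a) / (b - a) * b = x := by
      field_simp
      ring
    have h1 : (b - x) / (b - a) + (x - a) / (b - a) = 1 := by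
      field_simp
      ring
    refine ⟨(b - x) / (b - a), (x - a) / (b - a), div_nonneg (by linarith [hx.2]) hpos.le,
      div_nonneg (by linarith [hx.1]) hpos.le, h1, ?_⟩
    rw [key _ _ h1 (by rwa [e]), e]

theorem graph_union_graph {w : ℝ → ℂ} {a b c σ : ℝ} (h : a ≤ b) (h' : b ≤ c) :
    graph w a b σ ∪ graph w b c σ = graph w a c σ := by
  rw [graph, graph, ← Set.image_union, Set.Icc_union_Icc_eq_Icc h h', graph]

theorem quarter_image_segment (c p q : E3) :
    quarter c '' segment ℝ p q = segment ℝ (quarter c p) (quarter c q) :=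
  image_segment ℝ (AffineMap.const ℝ E3 c + (1 / 4 : ℝ) • AffineMap.id ℝ E3) p q

theorem quarter_pt (a b c x y z : ℝ) : quarter (pt a b c) (pt x y z) =
    pt (a + 1 / 4 * x) (b + 1 / 4 * y) (c + 1 / 4 * z) := by
  apply ext_coords <;> simp [quarter]

theorem segment_eq_graph_strand {ε a b σ y z y' z' : ℝ} (hab : a < b)
    {m n m' n' : ℝ} (hs : ∀ x ∈ Set.Icc a b, strand ε x = ⟨m + n * x, m' + n' * x⟩)
    (hy : y = σ * (m + n * a)) (hz : z = σ * (m' + n' * a)) (hy' : y' = σ * (m + n * b))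
    (hz' : z' = σ * (m' + n' * b)) :
    segment ℝ (pt a y z) (pt b y' z') = graph (strand ε) a b σ := by
  have ha := hs a ⟨le_rfl, hab.le⟩
  have hb := hs b ⟨hab.le, le_rfl⟩
  refine segment_eq_graph hab ?_ ?_ fun x hx => ?_
  · rw [ha]
    apply ext_coords <;> simp [cyl, hy, hz]
  · rw [hb]
    apply ext_coords <;> simp [cyl, hy', hz']
  · rw [ha, hb, hs x hx]
    apply Complex.ext <;> simp <;> ring

theorem right_strand_eq {ε σ : ℝ} :
    segment ℝ (pt (-1 / 4) (σ * (1 / 4)) 0) (pt (1 / 4) (σ * (1 / 4)) 0) ∪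
    segment ℝ (pt (1 / 4) (σ * (1 / 4)) 0) (pt (1 / 2) 0 (σ * ε / 4)) ∪
    segment ℝ (pt (1 / 2) 0 (σ * ε / 4)) (pt (3 / 4) (-σ * (1 / 4)) 0) ∪
    segment ℝ (pt (3 / 4) (-σ * (1 / 4)) 0) (pt 1 (-σ) 0) = graph (strand ε) (-1 / 4) 1 σ := by
  rw [segment_eq_graph_strand (ε := ε) (σ := σ) (m := 1 / 4) (n := 0) (m' := 0) (n' := 0),
    segment_eq_graph_strand (ε := ε) (σ := σ) (m := 1 / 2) (n := -1) (m' := -ε / 4) (n' := ε),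
    segment_eq_graph_strand (ε := ε) (σ := σ) (m := 1 / 2) (n := -1) (m' := ε * 3 / 4) (n' := -ε),
    segment_eq_graph_strand (ε := ε) (σ := σ) (m := 2) (n := -3) (m' := 0) (n' := 0)]
  · rw [graph_union_graph, graph_union_graph, graph_union_graph] <;> norm_num
  all_goals first
    | ring1
    | norm_num; done
    | skip
  · intro x hx
    rw [strand_of_ge ε hx.1]
    congr 1 <;> ring
  · intro x hx
    rw [strand_of_mem_right ε hx.1 hx.2]
    congr 1 <;> ring
  · intro x hx
    rw [strand_of_mem_left ε hx.1 hx.2]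
    congr 1 <;> ring
  · intro x hx
    rw [strand_of_le ε hx.2]
    congr 1 <;> ring

theorem left_strand_eq {σ : ℝ} : segment ℝ (pt (-1) σ 0) (pt (-3 / 4) (σ * (1 / 4)) 0) =
    graph (fun x => ⟨-3 * x - 2, 0⟩) (-1) (-3 / 4) σ := by
  refine segment_eq_graph (by norm_num) ?_ ?_ fun x _ => ?_
  · apply ext_coords <;> simp [cyl]
    norm_num
  · apply ext_coords <;> simp [cyl]
    norm_num
  · apply Complex.ext <;> simp
    ring

/-- Every arc outside the ball of `T` is a graph over the axis, and the arcs come in opposite pairs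
`±w`; radial maps, slides and twists can therefore be computed on them pointwise. -/
theorem toSpace_add_crossing {ε : ℝ} (hε : ε ^ 2 = 1) (T : Set B3) :
    toSpace (add T (crossing ε)) = quarter (pt (-1 / 2) 0 0) '' toSpace T ∪
      (graph (fun x => ⟨-3 * x - 2, 0⟩) (-1) (-3 / 4) 1 ∪
        graph (fun x => ⟨-3 * x - 2, 0⟩) (-1) (-3 / 4) (-1)) ∪
      (graph (strand ε) (-1 / 4) 1 1 ∪ graph (strand ε) (-1 / 4) 1 (-1)) := by
  rw [← left_strand_eq, ← left_strand_eq, ← right_strand_eq, ← right_strand_eq,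
    toSpace_add, toSpace_crossing hε]
  simp only [Set.image_union, quarter_image_segment, quarter_pt, addFrame]
  norm_num
  ring_nf
  ac_rfl

/-! ### Straightening the strands -/

/-- The distance from the axis to which the strands over `x` are moved. -/
noncomputable def straightRadius (x : ℝ) : ℝ := min (1 + 3 * x) ((4 + 3 * x) / 7)

/-- The radial displacement which moves the strands over `x` to distance `straightRadius x`. -/
noncomputable def straighten (ε x r : ℝ) : ℝ :=
  max r (min (min (straightRadius x + 6 * (r - ‖strand ε x‖)) (1 - (1 - r) / 10))
    (r + 3 * (x + 1 / 4)))

/-- The length by which points at distance `r` from the axis are translated. -/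
noncomputable def shiftLength (r : ℝ) : ℝ := min (1 / 2) (1 - r)

/-- The displacement parallel to the axis which moves the left summand to the centre. -/
noncomputable def shift (x r : ℝ) : ℝ :=
  max x (min (min (5 * x + 4) (x + shiftLength r)) ((1 + x) / 2))

/-- The bounds `5x + 4` and `(1 + x) / 2` meet `x` at `-1` and `1`, and `shiftLength r ≤ 0` for `r ≥
1`; so the maximum with `x` gives the identity off the cylinder. -/
theorem supported_shift : Supported (slide shift) := by
  refine supported_slide ?_ (fun r => ?_) (fun x r => le_max_left _ _) fun x r h => ?_
  · unfold shift shiftLength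
    fun_prop
  · intro a b hab
    refine max_lt_max hab (min_lt_min (min_lt_min ?_ ?_) ?_) <;> linarith
  · refine max_eq_left ?_
    rcases h with h | h
    · rcases le_abs.1 h with h | h
      · exact (min_le_right _ _).trans (by linarith)
      · exact (min_le_left _ _).trans ((min_le_left _ _).trans (by linarith))
    · refine (min_le_left _ _).trans ((min_le_right _ _).trans ?_)
      linarith [min_le_right (1 / 2) (1 - r), show shiftLength r = min (1 / 2) (1 - r) from rfl]

theorem straightRadius_le_left (x : ℝ) : straightRadius x ≤ 1 + 3 * x := min_le_left _ _

theorem straightRadius_le_right (x : ℝ) : straightRadius x ≤ (4 + 3 * x) / 7 := min_le_right _ _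

theorem straightRadius_of_le {x : ℝ} (h : x ≤ -1 / 6) : straightRadius x = 1 + 3 * x :=
  min_eq_left (by linarith)

theorem straightRadius_of_ge {x : ℝ} (h : -1 / 6 ≤ x) : straightRadius x = (4 + 3 * x) / 7 :=
  min_eq_right (by linarith)

theorem straighten_of_le_neg (ε r : ℝ) {x : ℝ} (h : x ≤ -1 / 4) : straighten ε x r = r :=
  max_eq_left ((min_le_right _ _).trans (by linarith))

theorem straighten_eq_self_of_le {ε x r : ℝ}
    (h : straightRadius x + 6 * (r - ‖strand ε x‖) ≤ r) : straighten ε x r = r :=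
  max_eq_left ((min_le_left _ _).trans ((min_le_left _ _).trans h))

/-- Each term of the minimum has one task. The steep line takes the value `straightRadius x` on the
strand, and slope `6` with `‖strand ε x‖ ≥ 1/6` keeps it nonpositive on the axis for `x ≤ 3/4`. The
second term meets `r` at `r = 1`, and the third makes the map trivial for `x ≤ -1/4`. -/
theorem supported_straighten {ε : ℝ} (hε : ε ^ 2 = 1) : Supported (radial (straighten ε)) := by
  refine supported_radial ?_ (fun x => ?_) (fun x => ?_) (fun x r => le_max_left _ _)
    fun x r h => ?_
  · have := continuous_strand ε
    unfold straighten straightRadius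
    fun_prop
  · refine straighten_eq_self_of_le ?_
    have h1 := one_sixth_le_norm_strand hε x
    have h2 := straightRadius_le_right x
    rcases le_total x (3 / 4) with h | h
    · linarith
    · rw [norm_strand_of_ge ε h]
      linarith
  · intro a b hab
    refine max_lt_max hab (min_lt_min (min_lt_min ?_ ?_) ?_) <;> linarith
  · rcases le_total 1 r with hr | hr
    · exact max_eq_left ((min_le_left _ _).trans ((min_le_right _ _).trans (by linarith)))
    · rcases h with h | h
      · rcases le_abs.1 h with h | h
        · refine straighten_eq_self_of_le ?_
          rw [norm_strand_of_ge ε (by linarith)]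
          linarith [straightRadius_le_right x]
        · exact straighten_of_le_neg ε r (by linarith)
      · obtain rfl : r = 1 := le_antisymm hr h
        exact max_eq_left ((min_le_left _ _).trans ((min_le_right _ _).trans (by linarith)))

theorem straightRadius_mem {x : ℝ} (h : x ∈ Set.Icc (-1 / 4 : ℝ) 1) :
    straightRadius x ∈ Set.Icc (1 / 4 : ℝ) 1 := by
  obtain ⟨h0, h1⟩ := h
  exact ⟨le_min (by linarith) (by linarith), (straightRadius_le_right x).trans (by linarith)⟩

/-- On the strand the two caps do not interfere. The last one is sharp: for `x ≤ 1/4` it equals `1 +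
3x`, the first branch of `straightRadius`. -/
theorem straighten_strand {ε x : ℝ} (hε : ε ^ 2 = 1) (h : x ∈ Set.Icc (-1 / 4 : ℝ) 1) :
    straighten ε x ‖strand ε x‖ = straightRadius x := by
  have h16 := one_sixth_le_norm_strand hε x
  have hl := straightRadius_le_left x
  have hr := straightRadius_le_right x
  have hm := (straightRadius_mem h).1
  have e : ‖strand ε x‖ ≤ straightRadius x ∧
      straightRadius x ≤ 1 - (1 - ‖strand ε x‖) / 10 ∧
      straightRadius x ≤ ‖strand ε x‖ + 3 * (x + 1 / 4) := by
    rcases le_total x (3 / 4) with hx | hx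
    · have := norm_strand_le hε hx
      refine ⟨by linarith, by linarith, ?_⟩
      rcases le_total x (1 / 4) with hx' | hx'
      · rw [norm_strand_of_le ε hx']
        linarith
      · linarith
    · rw [norm_strand_of_ge ε hx, straightRadius_of_ge (by linarith)]
      refine ⟨by linarith [h.2], by linarith [h.2], by linarith⟩
  rw [straighten, sub_self, mul_zero, add_zero, min_eq_left e.2.1, min_eq_left e.2.2,
    max_eq_right e.1]

theorem shiftLength_of_le {r : ℝ} (h : r ≤ 1 / 2) : shiftLength r = 1 / 2 :=
  min_eq_left (by linarith)

theorem shiftLength_of_ge {r : ℝ} (h : 1 / 2 ≤ r) : shiftLength r = 1 - r :=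
  min_eq_right (by linarith)

theorem shift_eq {x r : ℝ} (h0 : 0 ≤ shiftLength r) (h1 : shiftLength r ≤ 4 * x + 4)
    (h2 : shiftLength r ≤ (1 - x) / 2) : shift x r = x + shiftLength r := by
  rw [shift, min_eq_right (b := x + shiftLength r) (by linarith), min_eq_left (by linarith),
    max_eq_right (by linarith)]

/-- The horizontal coordinate to which the straightened strands over `x` are moved. -/
noncomputable def straightPos (x : ℝ) : ℝ := x + shiftLength (straightRadius x)

theorem shift_right {x : ℝ} (h : x ∈ Set.Icc (-1 / 4 : ℝ) 1) :
    shift x (straightRadius x) = straightPos x := by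
  obtain ⟨h0, h1⟩ := h
  rcases le_total x (-1 / 6) with hx | hx
  · have e : shiftLength (straightRadius x) = 1 / 2 := by
      rw [straightRadius_of_le hx, shiftLength_of_le (by linarith)]
    exact shift_eq (by linarith) (by linarith) (by linarith)
  · have e : shiftLength (straightRadius x) = 1 - (4 + 3 * x) / 7 := by
      rw [straightRadius_of_ge hx, shiftLength_of_ge (by linarith)]
    exact shift_eq (by linarith) (by linarith) (by linarith)

/-- This symmetry dictates `straightRadius`. The left strands have radius `R` at `-(2 + R)/3`; after
translation by `s = shiftLength R` they are opposite the right ones when `x = (2 + R)/3 - 2s`.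
Solving with `s = 1/2` gives `R = 1 + 3x`, and with `s = 1 - R` gives `R = (4 + 3x)/7`. -/
theorem shift_left {x : ℝ} (h : x ∈ Set.Icc (-1 / 4 : ℝ) 1) :
    shift (-(2 + straightRadius x) / 3) (straightRadius x) = -straightPos x := by
  obtain ⟨h0, h1⟩ := h
  rw [straightPos]
  rcases le_total x (-1 / 6) with hx | hx
  · have e' := straightRadius_of_le hx
    have e : shiftLength (straightRadius x) = 1 / 2 := by
      rw [straightRadius_of_le hx, shiftLength_of_le (by linarith)]
    rw [shift_eq] <;> linarith
  · have e' := straightRadius_of_ge hx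
    have e : shiftLength (straightRadius x) = 1 - (4 + 3 * x) / 7 := by
      rw [straightRadius_of_ge hx, shiftLength_of_ge (by linarith)]
    rw [shift_eq] <;> linarith

/-- The map which moves the left summand to the centre and straightens the strands of a crossing
added on its right up to rotation around the axis. -/
noncomputable def centre (ε : ℝ) : E3 → E3 := slide shift ∘ radial (straighten ε)

theorem supported_centre {ε : ℝ} (hε : ε ^ 2 = 1) : Supported (centre ε) :=
  supported_shift.comp (supported_straighten hε)

theorem centre_of_straighten_eq {ε : ℝ} {p : E3}
    (h : straighten ε (p 0) ‖tr p‖ = ‖tr p‖) :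
    centre ε p = cyl (shift (p 0) ‖tr p‖) (tr p) := by
  have : radial (straighten ε) p = p := by
    rw [radial, h]
    by_cases hp : tr p = 0
    · rw [hp, smul_zero, ← hp, cyl_eta]
    · rw [div_self (norm_ne_zero_iff.2 hp), one_smul, cyl_eta]
  rw [centre, Function.comp_apply, this, slide]

/-- The radial map fixes the small ball, and the slide translates all of it by `1/2`, since its
points have `r ≤ 1/2`. -/
theorem centre_quarter (ε : ℝ) {p : E3} (hp : ‖p‖ ≤ Real.sqrt 2) :
    centre ε (quarter (pt (-1 / 2) 0 0) p) = (1 / 4 : ℝ) • p := by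
  set x := p 0 with hx
  set r := ‖tr p‖ with hr
  have hsq : x ^ 2 + r ^ 2 ≤ 2 := by
    rwa [Real.le_sqrt (norm_nonneg _) (by norm_num), norm_sq_cyl] at hp
  have hr0 : 0 ≤ r := norm_nonneg _
  have h0 : quarter (pt (-1 / 2) 0 0) p 0 = -1 / 2 + x / 4 := by
    simp [quarter]
    ring
  have h2 : tr (quarter (pt (-1 / 2) 0 0) p) = (1 / 4 : ℝ) • tr p := by
    rw [quarter, tr_add, tr_smul]
    exact zero_add _
  have h3 : ‖(1 / 4 : ℝ) • tr p‖ = r / 4 := by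
    rw [norm_smul, ← hr, Real.norm_eq_abs, abs_of_pos (by norm_num)]
    ring
  have hsum : x + r ≤ 2 := by nlinarith [sq_nonneg (x - r)]
  have hx1 : -3 / 2 ≤ x := by nlinarith
  rw [centre_of_straighten_eq, h0, h2, h3, shift_eq, shiftLength_of_le]
  · rw [← cyl_eta ((1 / 4 : ℝ) • p), tr_smul]
    congr 1
    simp only [PiLp.smul_apply, smul_eq_mul, ← hx]
    ring
  · linarith [show r ≤ 3 / 2 by nlinarith]
  all_goals
    first
    | rw [shiftLength_of_le (by nlinarith)]
      linarith
    | rw [h0, h2, h3]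
  -- Beyond `-1/4` the ball protrudes into the region of straightening, but there `x ≥ 1` and `x + r
  -- ≤ 2` give `3x + 5r ≤ 8`, which leaves it fixed. Equality holds at the eastern endpoints of `T`.
  rcases le_total (-1 / 2 + x / 4) (-1 / 4) with h | h
  · exact straighten_of_le_neg ε _ h
  · refine straighten_eq_self_of_le ?_
    rw [norm_strand_of_le ε (by linarith)]
    linarith [straightRadius_le_left (-1 / 2 + x / 4)]

theorem norm_sign_smul {σ : ℝ} (hσ : |σ| = 1) (w : ℂ) : ‖σ • w‖ = ‖w‖ := by
  rw [norm_smul, Real.norm_eq_abs, hσ, one_mul]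

/-- The direction of a strand over `x`. -/
noncomputable def strandDir (ε x : ℝ) : ℂ := ‖strand ε x‖⁻¹ • strand ε x

theorem norm_strandDir {ε : ℝ} (hε : ε ^ 2 = 1) (x : ℝ) : ‖strandDir ε x‖ = 1 := by
  rw [strandDir, norm_smul, norm_inv, norm_norm, inv_mul_cancel₀ (norm_strand_pos hε x).ne']

theorem centre_right {ε σ x : ℝ} (hε : ε ^ 2 = 1) (hσ : |σ| = 1)
    (h : x ∈ Set.Icc (-1 / 4 : ℝ) 1) : centre ε (cyl x (σ • strand ε x)) =
    cyl (straightPos x) (σ • straightRadius x • strandDir ε x) := by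
  have e : radial (straighten ε) (cyl x (σ • strand ε x)) =
      cyl x (σ • straightRadius x • strandDir ε x) := by
    rw [radial, tr_cyl, cyl_zero, norm_sign_smul hσ, straighten_strand hε h, strandDir,
      smul_comm _ σ, smul_smul (straightRadius x), div_eq_mul_inv]
  have hn : ‖σ • straightRadius x • strandDir ε x‖ = straightRadius x := by
    rw [norm_sign_smul hσ, norm_smul, norm_strandDir hε, mul_one, Real.norm_eq_abs,
      abs_of_nonneg (by linarith [(straightRadius_mem h).1])]
  rw [centre, Function.comp_apply, e, slide, tr_cyl, cyl_zero, hn, shift_right h]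

theorem centre_left {σ x : ℝ} (ε : ℝ) (hσ : |σ| = 1)
    (h : x ∈ Set.Icc (-1 / 4 : ℝ) 1) :
    centre ε (cyl (-(2 + straightRadius x) / 3) (σ • (straightRadius x : ℂ))) =
    cyl (-straightPos x) (σ • (straightRadius x : ℂ)) := by
  have hm := (straightRadius_mem h).1
  have hn : ‖σ • (straightRadius x : ℂ)‖ = straightRadius x := by
    rw [norm_sign_smul hσ, Complex.norm_real, Real.norm_eq_abs, abs_of_nonneg (by linarith)]
  rw [centre_of_straighten_eq, tr_cyl, cyl_zero, hn, shift_left h]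
  exact straighten_of_le_neg ε _ (by rw [cyl_zero]; linarith)

/-- The left strands, parametrized by the opposite points of the right strands. -/
theorem graph_left_eq (σ : ℝ) : graph (fun x => ⟨-3 * x - 2, 0⟩) (-1) (-3 / 4) σ =
    (fun x => cyl (-(2 + straightRadius x) / 3) (σ • (straightRadius x : ℂ))) ''
      Set.Icc (-1 / 4) 1 := by
  ext p
  constructor
  · rintro ⟨x, ⟨h0, h1⟩, rfl⟩
    obtain ⟨y, hy, hyx⟩ : ∃ y ∈ Set.Icc (-1 / 4 : ℝ) 1, straightRadius y = -3 * x - 2 := by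
      have hc : Continuous straightRadius := by
        unfold straightRadius
        fun_prop
      refine intermediate_value_Icc (by norm_num) hc.continuousOn ⟨?_, ?_⟩
      · rw [straightRadius_of_le (by norm_num)]
        linarith
      · rw [straightRadius_of_ge (by norm_num)]
        linarith
    refine ⟨y, hy, ?_⟩
    dsimp only
    rw [hyx]
    congr 1
    ring
  · rintro ⟨y, hy, rfl⟩
    obtain ⟨h0, h1⟩ := straightRadius_mem hy
    refine ⟨-(2 + straightRadius y) / 3, ⟨by linarith, by linarith⟩, ?_⟩
    dsimp only
    congr 2
    apply Complex.ext
    · simp only [Complex.ofReal_re]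
      ring
    · simp

/-- The images of the strands of `T + [ε]` on the right of `T`. -/
noncomputable def rightArc (ε σ : ℝ) : Set E3 :=
  (fun x => cyl (straightPos x) (σ • straightRadius x • strandDir ε x)) '' Set.Icc (-1 / 4) 1

/-- The images of the strands of `T + [ε]` on the left of `T`. -/
noncomputable def leftArc (σ : ℝ) : Set E3 :=
  (fun x => cyl (-straightPos x) (σ • (straightRadius x : ℂ))) '' Set.Icc (-1 / 4) 1

/-- Normal position: `leftArc` and `rightArc` now have the same radius at opposite positions and
differ only by the factor `strandDir`. -/
theorem centre_image_add {ε : ℝ} (hε : ε ^ 2 = 1) (T : Set B3) :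
    centre ε '' toSpace (add T (crossing ε)) = (fun p => (1 / 4 : ℝ) • p) '' toSpace T ∪
      (leftArc 1 ∪ leftArc (-1)) ∪ (rightArc ε 1 ∪ rightArc ε (-1)) := by
  have hR : ∀ σ : ℝ, |σ| = 1 → centre ε '' graph (strand ε) (-1 / 4) 1 σ = rightArc ε σ := by
    intro σ hσ
    rw [graph, Set.image_image]
    exact Set.image_congr fun x hx => centre_right hε hσ hx
  have hL : ∀ σ : ℝ, |σ| = 1 →
      centre ε '' graph (fun x => ⟨-3 * x - 2, 0⟩) (-1) (-3 / 4) σ = leftArc σ := by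
    intro σ hσ
    rw [graph_left_eq, Set.image_image]
    exact Set.image_congr fun x hx => centre_left ε hσ hx
  rw [toSpace_add_crossing hε]
  simp only [Set.image_union]
  rw [hR 1 (by simp), hR (-1) (by simp), hL 1 (by simp), hL (-1) (by simp), Set.image_image]
  congr 2
  refine Set.image_congr ?_
  rintro _ ⟨p, _, rfl⟩
  exact centre_quarter ε (norm_coe_le p)

/-! ### The flype -/

/-- The rotation around the axis which flips the central ball. -/
noncomputable def flypeAngle (ε x r : ℝ) : ℂ :=
  -(starRingEnd ℂ) (strandDir ε ((7 * max |x| ((4 * r - 1) / 3) - 3) / 4))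

theorem strandDir_of_le (ε : ℝ) {x : ℝ} (h : x ≤ 1 / 4) : strandDir ε x = 1 := by
  rw [strandDir, norm_strand_of_le ε h, strand_of_le ε h]
  apply Complex.ext <;> simp

theorem strandDir_of_ge (ε : ℝ) {x : ℝ} (h : 3 / 4 ≤ x) : strandDir ε x = -1 := by
  have : 3 * x - 2 ≠ 0 := by linarith
  rw [strandDir, norm_strand_of_ge ε h, strand_of_ge ε h]
  apply Complex.ext
  · rw [Complex.smul_re, smul_eq_mul, inv_mul_eq_iff_eq_mul₀ this]
    simp
  · rw [Complex.smul_im]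
    simp

theorem flypeAngle_of_le (ε : ℝ) {x r : ℝ} (hx : |x| ≤ 4 / 7) (hr : r ≤ 4 / 7) :
    flypeAngle ε x r = -1 := by
  have : max |x| ((4 * r - 1) / 3) ≤ 4 / 7 := max_le hx (by linarith)
  rw [flypeAngle, strandDir_of_le ε (by linarith), map_one]

/-- Off the cylinder the argument of `strandDir` is at least `1`, where the strands have completed
their half turn: the direction is `-1` and the rotation factor `1`. -/
theorem supported_flype {ε : ℝ} (hε : ε ^ 2 = 1) : Supported (twist (flypeAngle ε)) := by
  refine supported_twist ?_ (fun x r => ?_) fun x r h => ?_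
  · have h1 := continuous_strand ε
    have h2 : Continuous (strandDir ε) :=
      (h1.norm.inv₀ fun x => (norm_strand_pos hε x).ne').smul h1
    have h3 : Continuous fun a : ℝ × ℝ => (7 * max |a.1| ((4 * a.2 - 1) / 3) - 3) / 4 := by
      fun_prop
    exact (Complex.continuous_conj.comp (h2.comp h3)).neg
  · rw [flypeAngle, norm_neg, RCLike.norm_conj, norm_strandDir hε]
  · have : 1 ≤ max |x| ((4 * r - 1) / 3) := by
      rcases h with h | h
      · exact h.trans (le_max_left _ _)
      · exact le_trans (by linarith) (le_max_right _ _)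
    rw [flypeAngle, strandDir_of_ge ε (by linarith)]
    simp

/-- For `x ≥ -1/6` one has `straightPos x = (4x + 3)/7 = (4 * straightRadius x - 1)/3`, so both
entries of the maximum agree on the strands and `(7 * · - 3)/4` recovers `x`. For smaller `x` both
sides are `-1`. -/
theorem flypeAngle_straight (ε : ℝ) {x t : ℝ} (h : x ∈ Set.Icc (-1 / 4 : ℝ) 1)
    (ht : |t| = straightPos x) :
    flypeAngle ε t (straightRadius x) = -(starRingEnd ℂ) (strandDir ε x) := by
  obtain ⟨h0, h1⟩ := h
  rcases le_total x (-1 / 6) with hx | hx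
  · have e' := straightRadius_of_le hx
    have e : shiftLength (straightRadius x) = 1 / 2 := by
      rw [straightRadius_of_le hx, shiftLength_of_le (by linarith)]
    rw [straightPos] at ht
    rw [flypeAngle_of_le ε (by linarith) (by linarith), strandDir_of_le ε (by linarith), map_one]
  · have e' := straightRadius_of_ge hx
    have e : shiftLength (straightRadius x) = 1 - (4 + 3 * x) / 7 := by
      rw [straightRadius_of_ge hx, shiftLength_of_ge (by linarith)]
    rw [straightPos] at ht
    rw [flypeAngle, ht, max_eq_left (by linarith)]
    congr 3
    linarith

theorem twist_centre {ε : ℝ} {p : E3} (hp : ‖p‖ ≤ Real.sqrt 2) :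
    twist (flypeAngle ε) ((1 / 4 : ℝ) • p) = (1 / 4 : ℝ) • hRot p := by
  have h1 : p 0 ^ 2 + ‖tr p‖ ^ 2 ≤ 2 := by
    rwa [Real.le_sqrt (norm_nonneg _) (by norm_num), norm_sq_cyl] at hp
  have h2 : |p 0| ≤ 3 / 2 := abs_le_of_sq_le_sq (by nlinarith [sq_nonneg ‖tr p‖]) (by norm_num)
  have h3 : ‖tr p‖ ≤ 3 / 2 := by nlinarith [sq_nonneg (p 0)]
  have h4 : ((1 / 4 : ℝ) • p) 0 = 1 / 4 * p 0 := rfl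
  rw [twist, flypeAngle_of_le, hRot_apply]
  · apply ext_coords <;> simp [cyl, tr]
  · rw [h4, abs_mul, abs_of_pos (by norm_num : (0 : ℝ) < 1 / 4)]
    linarith
  · rw [tr_smul, norm_smul, Real.norm_eq_abs, abs_of_pos (by norm_num : (0 : ℝ) < 1 / 4)]
    linarith

theorem straightPos_nonneg {x : ℝ} (h : x ∈ Set.Icc (-1 / 4 : ℝ) 1) : 0 ≤ straightPos x := by
  obtain ⟨h0, h1⟩ := h
  rw [straightPos]
  rcases le_total x (-1 / 6) with hx | hx
  · rw [straightRadius_of_le hx, shiftLength_of_le] <;> linarith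
  · rw [straightRadius_of_ge hx, shiftLength_of_ge] <;> linarith

/-- In cylindrical coordinates `vRot` is `(x, w) ↦ (-x, conj w)`. Hence the factor `-conj (strandDir
ε x)` gives the left strands exactly the twist of a reversed right strand, with the opposite sign.
-/
theorem twist_leftArc {ε σ : ℝ} (hσ : |σ| = 1) :
    twist (flypeAngle ε) '' leftArc σ = vRot '' rightArc ε (-σ) := by
  rw [leftArc, rightArc, Set.image_image, Set.image_image]
  refine Set.image_congr fun x hx => ?_
  have hm := (straightRadius_mem hx).1
  have hn : ‖σ • (straightRadius x : ℂ)‖ = straightRadius x := by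
    rw [norm_sign_smul hσ, Complex.norm_real, Real.norm_eq_abs, abs_of_nonneg (by linarith)]
  rw [twist, tr_cyl, cyl_zero, hn,
    flypeAngle_straight ε hx (by rw [abs_neg, abs_of_nonneg (straightPos_nonneg hx)]), vRot_apply]
  apply ext_coords <;> simp [cyl] <;> ring

/-- Here the conjugate direction cancels the direction of the strand, leaving the constant direction
`-σ`. -/
theorem twist_rightArc {ε σ : ℝ} (hε : ε ^ 2 = 1) (hσ : |σ| = 1) :
    twist (flypeAngle ε) '' rightArc ε σ = vRot '' leftArc (-σ) := by
  rw [leftArc, rightArc, Set.image_image, Set.image_image]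
  refine Set.image_congr fun x hx => ?_
  have hm := (straightRadius_mem hx).1
  have hn : ‖σ • straightRadius x • strandDir ε x‖ = straightRadius x := by
    rw [norm_sign_smul hσ, norm_smul, norm_strandDir hε, mul_one, Real.norm_eq_abs,
      abs_of_nonneg (by linarith)]
  have hu : (starRingEnd ℂ) (strandDir ε x) * strandDir ε x = 1 := by
    rw [← Complex.normSq_eq_conj_mul_self, Complex.normSq_eq_norm_sq, norm_strandDir hε]
    simp
  rw [twist, tr_cyl, cyl_zero, hn,
    flypeAngle_straight ε hx (abs_of_nonneg (straightPos_nonneg hx)), vRot_apply,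
    mul_smul_comm, mul_smul_comm, neg_mul, hu]
  apply ext_coords <;> simp [cyl]

/-- The flype: a crossing on the right of `T` is moved to the left by flipping `T`. -/
theorem isotopic_flype {ε : ℝ} (hε : ε ^ 2 = 1) (T : Set B3) :
    Isotopic (add T (crossing ε)) (add (crossing ε) (hflip T)) := by
  have hC := supported_centre hε
  -- The vertical half turn takes the right side of the flype to a sum with the crossing on the
  -- right, so its normal position comes from the same `centre`, conjugated by `vRot`.
  refine ((supported_flype hε).comp hC).isotopic₂ (hC.conj vRot) ?_
  have hv : ∀ p, vRot (vRot p) = p := fun p => by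
    simp only [vRot_apply, pt_zero, pt_one, pt_two, neg_neg, pt_eta]
  have e : vRot.symm '' toSpace (add (crossing ε) (hflip T)) =
      toSpace (add (vflip (hflip T)) (crossing ε)) := by
    conv_rhs => rw [← vflip_crossing hε, ← vflip_add, vflip_eq_act, toSpace_act]
    rfl
  rw [Set.image_comp, centre_image_add hε, show (fun p => vRot (centre ε (vRot.symm p))) =
    vRot ∘ centre ε ∘ vRot.symm from rfl, Set.image_comp, Set.image_comp, e, centre_image_add hε]
  simp only [Set.image_union]
  rw [twist_leftArc (by simp), twist_leftArc (by simp), twist_rightArc hε (by simp),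
    twist_rightArc hε (by simp), neg_neg]
  have hT : twist (flypeAngle ε) '' ((fun p => (1 / 4 : ℝ) • p) '' toSpace T) =
      vRot '' ((fun p => (1 / 4 : ℝ) • p) '' toSpace (vflip (hflip T))) := by
    rw [vflip_eq_act, hflip_eq_act, toSpace_act, toSpace_act]
    simp only [Set.image_image, map_smul, hv]
    refine Set.image_congr ?_
    rintro _ ⟨p, _, rfl⟩
    exact twist_centre (norm_coe_le p)
  rw [hT]
  ac_rfl

/-! ### Rational tangles are invariant under flips -/

/-- A tangle is flip invariant if it is isotopic to its horizontal and vertical flips. -/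
def FlipInvariant (T : Set B3) : Prop := Isotopic T (hflip T) ∧ Isotopic T (vflip T)

theorem Isotopic.hflip {T S : Set B3} (h : Isotopic T S) : Isotopic (hflip T) (hflip S) := by
  simpa only [hflip_eq_act] using h.act hRot

theorem Isotopic.vflip {T S : Set B3} (h : Isotopic T S) : Isotopic (vflip T) (vflip S) := by
  simpa only [vflip_eq_act] using h.act vRot

theorem Isotopic.rot {T S : Set B3} (h : Isotopic T S) : Isotopic (rot T) (rot S) := h.act ccw

theorem Isotopic.rotCW {T S : Set B3} (h : Isotopic T S) : Isotopic (rotCW T) (rotCW S) :=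
  h.act ccw.symm

theorem Isotopic.mirror {T S : Set B3} (h : Isotopic T S) : Isotopic (mirror T) (mirror S) := by
  simpa only [mirror_eq_act] using h.act zRefl

theorem act_congr {g h : E3 ≃ₗᵢ[ℝ] E3} (e : ∀ p, g p = h p) (T : Set B3) : act g T = act h T := by
  rw [LinearIsometryEquiv.ext e]

theorem hflip_vflip (T : Set B3) : hflip (vflip T) = rot (rot T) := by
  rw [hflip_eq_act, vflip_eq_act, rot_eq_act, rot_eq_act, act_act, act_act]
  refine act_congr (fun p => ?_) T
  simp [hRot_apply, vRot_apply, ccw_apply]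

theorem hflip_hflip (T : Set B3) : hflip (hflip T) = T := by
  refine toSpace_injective ?_
  simp [hflip_eq_act, toSpace_act, Set.image_image, hRot_apply, pt_eta]

theorem vflip_vflip (T : Set B3) : vflip (vflip T) = T := by
  refine toSpace_injective ?_
  simp [vflip_eq_act, toSpace_act, Set.image_image, vRot_apply, pt_eta]

theorem hflip_rotCW (T : Set B3) : hflip (rotCW T) = rotCW (vflip T) := by
  rw [hflip_eq_act, vflip_eq_act, rotCW_eq_act, rotCW_eq_act, act_act, act_act]
  refine act_congr (fun p => ?_) T
  simp [hRot_apply, vRot_apply, ccw_symm_apply]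

theorem vflip_rotCW (T : Set B3) : vflip (rotCW T) = rotCW (hflip T) := by
  rw [hflip_eq_act, vflip_eq_act, rotCW_eq_act, rotCW_eq_act, act_act, act_act]
  refine act_congr (fun p => ?_) T
  simp [hRot_apply, vRot_apply, ccw_symm_apply]

theorem rotCW_rot (T : Set B3) : rotCW (rot T) = T := by
  refine toSpace_injective ?_
  simp [rotCW_eq_act, rot_eq_act, toSpace_act, Set.image_image]

theorem rot_rot_eq_rotCW (T : Set B3) : rot (rot T) = rotCW (rotCW T) := by
  rw [rot_eq_act, rot_eq_act, rotCW_eq_act, rotCW_eq_act, act_act, act_act]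
  refine act_congr (fun p => ?_) T
  simp [ccw_apply, ccw_symm_apply]

theorem inv_inv (T : Set B3) : inv (inv T) = rot (rot T) := by
  refine toSpace_injective ?_
  simp [inv, mirror_eq_act, rot_eq_act, toSpace_act, Set.image_image, zRefl_apply, ccw_apply]

namespace FlipInvariant

theorem isotopic {T S : Set B3} (hT : FlipInvariant T) (h : Isotopic T S) : FlipInvariant S :=
  ⟨h.symm.trans (hT.1.trans h.hflip), h.symm.trans (hT.2.trans h.vflip)⟩

theorem vflip {T : Set B3} (h : FlipInvariant T) : FlipInvariant (vflip T) := h.isotopic h.2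

theorem rotCW {T : Set B3} (h : FlipInvariant T) : FlipInvariant (rotCW T) :=
  ⟨hflip_rotCW T ▸ h.2.rotCW, vflip_rotCW T ▸ h.1.rotCW⟩

theorem isotopic_rot_rot {T : Set B3} (h : FlipInvariant T) : Isotopic T (rot (rot T)) :=
  hflip_vflip T ▸ h.1.trans h.2.hflip

theorem rot {T : Set B3} (h : FlipInvariant T) : FlipInvariant (rot T) := by
  have := (h.isotopic h.isotopic_rot_rot).rotCW
  rwa [rotCW_rot] at this

/-- The heart of the induction: replace `T` by `(T^r)^r`, then flype. The flype applies the
horizontal flip, and `((T^r)^r)^{hflip} = T^{vflip}` is what the vertical flip of the sum requires.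
-/
theorem add_crossing {T : Set B3} (h : FlipInvariant T) {ε : ℝ} (hε : ε ^ 2 = 1) :
    FlipInvariant (add T (crossing ε)) := by
  constructor
  · rw [hflip_add, hflip_crossing hε]
    exact h.1.add_right _
  · have e : hflip (RatTangle.rot (RatTangle.rot T)) = RatTangle.vflip T := by
      rw [← hflip_vflip, hflip_hflip]
    rw [vflip_add, vflip_crossing hε, ← e]
    exact (h.isotopic_rot_rot.add_right _).trans (isotopic_flype hε _)

/-- The vertical flip reverses the order of the summands. -/
theorem crossing_add {T : Set B3} (h : FlipInvariant T) {ε : ℝ} (hε : ε ^ 2 = 1) :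
    FlipInvariant (add (crossing ε) T) := by
  have := (h.vflip.add_crossing hε).vflip
  rwa [vflip_add, vflip_crossing hε, vflip_vflip] at this

/-- A quarter turn yields a sum with the crossing of sign `-ε`; turning back preserves invariance,
as it merely exchanges the roles of the two flips. -/
theorem mul_crossing {T : Set B3} (h : FlipInvariant T) {ε : ℝ} (hε : ε ^ 2 = 1) :
    FlipInvariant (mul T (crossing ε)) := by
  have := (h.rot.add_crossing (ε := -ε) (by rwa [neg_sq])).rotCW
  rwa [← rot_crossing hε, ← rot_mul, rotCW_rot] at this

theorem crossing_mul {T : Set B3} (h : FlipInvariant T) {ε : ℝ} (hε : ε ^ 2 = 1) :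
    FlipInvariant (mul (crossing ε) T) := by
  have := (h.rot.crossing_add (ε := -ε) (by rwa [neg_sq])).rotCW
  rwa [← rot_crossing hε, ← rot_mul, rotCW_rot] at this

end FlipInvariant

theorem flipInvariant_zero : FlipInvariant zero :=
  ⟨hflip_zero.symm ▸ Isotopic.refl _, vflip_zero.symm ▸ Isotopic.refl _⟩

theorem flipInvariant_infty : FlipInvariant infty := by
  have := flipInvariant_zero.rotCW
  rwa [← rot_infty, rotCW_rot] at this

theorem exists_crossing {e : Set B3} (he : e = posOne ∨ e = negOne) :
    ∃ ε : ℝ, ε ^ 2 = 1 ∧ e = crossing ε := by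
  rcases he with rfl | rfl
  · exact ⟨1, by norm_num, rfl⟩
  · exact ⟨-1, by norm_num, rfl⟩

theorem TwistForm.flipInvariant {T : Set B3} (h : TwistForm T) : FlipInvariant T := by
  induction h with
  | zero => exact flipInvariant_zero
  | infty => exact flipInvariant_infty
  | add_right he _ ih =>
    obtain ⟨ε, hε, rfl⟩ := exists_crossing he
    exact ih.add_crossing hε
  | add_left he _ ih =>
    obtain ⟨ε, hε, rfl⟩ := exists_crossing he
    exact ih.crossing_add hε
  | mul_bottom he _ ih =>
    obtain ⟨ε, hε, rfl⟩ := exists_crossing he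
    exact ih.mul_crossing hε
  | mul_top he _ ih =>
    obtain ⟨ε, hε, rfl⟩ := exists_crossing he
    exact ih.crossing_mul hε

theorem Rational.flipInvariant {T : Set B3} (h : Rational T) : FlipInvariant T := by
  obtain ⟨S, hS, hST⟩ := h
  exact hS.flipInvariant.isotopic hST

end RatTangle

theorem lemma2 (T : Set RatTangle.B3) (hT : RatTangle.Rational T) :
    RatTangle.Isotopic T (RatTangle.hflip T) ∧
    RatTangle.Isotopic T (RatTangle.vflip T) ∧
    (RatTangle.Isotopic T (RatTangle.inv (RatTangle.inv T)) ∧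
      RatTangle.inv (RatTangle.inv T) = RatTangle.rot (RatTangle.rot T)) ∧
    RatTangle.Isotopic (RatTangle.inv T) (RatTangle.invNeg T) := by
  have h := hT.flipInvariant
  refine ⟨h.1, h.2, ⟨?_, RatTangle.inv_inv T⟩, ?_⟩
  · rw [RatTangle.inv_inv]
    exact h.isotopic_rot_rot
  -- Three counterclockwise quarter turns make one clockwise quarter turn, so `T^r` is isotopic to
  -- the clockwise turn of `T`; it remains to take mirror images.
  · have := h.isotopic_rot_rot.rot
    rw [RatTangle.rot_rot_eq_rotCW, RatTangle.rotCW_rot] at this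
    exact this.mirror
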